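/- Let $\mathcal Y$ be a non-empty compact Hausdorff space, $\mathcal H$ a complex Hilbert space, $C$ a bounded positive semi-definite operator on $\mathcal H$, and $(A_y)_{y\in\mathcal Y}$ a family of bounded positive semi-definite operators on $\mathcal H$. Let $\mathcal H^{\otimes n}$ be the $n$-fold Hilbert space tensor power. For every $n\ge 1$ let $\mathcal X_n$ be a set of bounded positive semi-definite operators on $\mathcal H^{\otimes n}$ such that (a) $A_y^{\otimes n}X$ and $C^{\otimes n}X$ are trace-class for all $n\ge 1$, $y\in\mathcal Y$, $X\in\mathcal X_n$; (b) $X_1\otimes X_2\in\mathcal X_{n+m}$ for all $n,m\ge 1$, $X_1\in\mathcal X_n$, $X_2\in\mathcal X_m$; (c) $y\mapsto \operatorname{Tr}A_y^{\otimes n}X$ is continuous on $\mathcal Y$ for all $n\ge 1$, $X\in\mathcal X_n$. "Measure" means a positive measure on the Borel $\sigma$-algebra of $\mathcal Y$. We use the conventions $\log 0=-\infty$, $e^{-\infty}=0$, and $\log(+\infty)=+\infty$. Consider the following statements. (i) There is a probability measure $\nu$ such that for all $n\ge 1$ and $X\in\mathcal X_n$, $$\operatorname{Tr}C^{\otimes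 n}X\le\exp\Big(\int_{\mathcal Y}\log\operatorname{Tr}A_y^{\otimes n}X\,d\nu(y)\Big).$$ (ii) For every $n\ge 1$ there is a probability measure $\nu_n$ such that for all $X\in\mathcal X_n$, $$\operatorname{Tr}C^{\otimes n}X\le\exp\Big(\int_{\mathcal Y}\log\operatorname{Tr}A_y^{\otimes n}X\,d\nu_n(y)\Big).$$ (iii) There is a probability measure $\mu$ such that for all $n\ge 1$ and $X\in\mathcal X_n$, $$\operatorname{Tr}C^{\otimes n}X\le\int_{\mathcal Y}\operatorname{Tr}A_y^{\otimes n}X\,d\mu(y).$$ (iv) There are measures $(\mu_n)_{n\ge1}$ with $\limsup_{n\to\infty}\frac1n\log\mu_n(\mathcal Y)\le 0$ such that for all $n\ge 1$ and $X\in\mathcal X_n$, $$\operatorname{Tr}C^{\otimes n}X\le\int_{\mathcal Y}\operatorname{Tr}A_y^{\otimes n}X\,d\mu_n(y).$$ (v) For all $n\ge 1$ and $X\in\mathcal X_n$, $$\operatorname{Tr}C^{\otimes n}X\le\sup_{y\in\mathcal Y}\operatorname{Tr}A_y^{\otimes n}X.$$ Then (i), (ii), (iii) and (iv) are equivalent,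 and each of them implies (v). -/

import Mathlib

open scoped TensorProduct ComplexConjugate ENNReal InnerProductSpace

noncomputable section

/-! ### The Hilbert space tensor powers of a Hilbert space -/

section TensorPowers

variable (H : Type*) [NormedAddCommGroup H] [InnerProductSpace ℂ H]

/-- The algebraic `n`-fold tensor power of `H`.  (A type synonym, so that it can carry the
Hilbert space norm.) -/
def AlgPow (n : ℕ) : Type _ := ⨂[ℂ] _ : Fin n, H

instance (n : ℕ) : AddCommGroup (AlgPow H n) := inferInstanceAs (AddCommGroup (⨂[ℂ] _ : Fin n, H))

instance (n : ℕ) : Module ℂ (AlgPow H n) := inferInstanceAs (Module ℂ (⨂[ℂ] _ : Fin n, H))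

variable {H}

namespace AlgPow

/-- The elementary tensor `x₀ ⊗ ⋯ ⊗ x₍ₙ₋₁₎`. -/
def tprod {n : ℕ} (x : Fin n → H) : AlgPow H n := PiTensorProduct.tprod ℂ x

/-- Concatenation of algebraic tensors. -/
def mulEquiv (n m : ℕ) : AlgPow H n ⊗[ℂ] AlgPow H m ≃ₗ[ℂ] AlgPow H (n + m) :=
  TensorPower.mulEquiv

/-- The algebraic tensor power `C ⊗ ⋯ ⊗ C` of a linear map. -/
def map (n : ℕ) (C : H →ₗ[ℂ] H) : AlgPow H n →ₗ[ℂ] AlgPow H n :=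
  PiTensorProduct.map fun _ => C

/-- The linear functional `u ↦ ⟪x₀ ⊗ ⋯ ⊗ x₍ₙ₋₁₎, u⟫`. -/
def pairing {n : ℕ} (x : Fin n → H) : AlgPow H n →ₗ[ℂ] ℂ :=
  PiTensorProduct.lift
    ((MultilinearMap.mkPiAlgebra ℂ (Fin n) ℂ).compLinearMap fun i => innerₛₗ ℂ (x i))

theorem pairing_tprod {n : ℕ} (x y : Fin n → H) :
    pairing x (tprod y) = ∏ i, ⟪x i, y i⟫_ℂ := by
  simp only [pairing, tprod]
  erw [PiTensorProduct.lift.tprod]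
  simp

theorem induction {n : ℕ} {p : AlgPow H n → Prop}
    (h1 : ∀ (c : ℂ) (x : Fin n → H), p (c • tprod x)) (h2 : ∀ u v, p u → p v → p (u + v))
    (u : AlgPow H n) : p u :=
  PiTensorProduct.induction_on (motive := p) u h1 h2

theorem linearMap_ext {n : ℕ} {F : Type*} [AddCommGroup F] [Module ℂ F] {σ : ℂ →+* ℂ}
    {f g : AlgPow H n →ₛₗ[σ] F}
    (h : ∀ x, f (tprod x) = g (tprod x)) : f = g := by
  ext u
  induction u using induction with
  | h1 c x => simp [h x]
  | h2 u v hu hv => simp [hu, hv]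


theorem star_pairing_tprod {n : ℕ} (x y : Fin n → H) :
    star (pairing x (tprod y)) =
      (MultilinearMap.mkPiAlgebra ℂ (Fin n) ℂ).compLinearMap (fun i => innerₛₗ ℂ (y i)) x := by
  simp [pairing_tprod, star_prod]

/-- The form `u ↦ (v ↦ ⟪v, u⟫)`, determined by
`⟪y₀ ⊗ ⋯ ⊗ y₍ₙ₋₁₎, x₀ ⊗ ⋯ ⊗ x₍ₙ₋₁₎⟫ = ∏ i, ⟪yᵢ, xᵢ⟫`. -/
def form (n : ℕ) : AlgPow H n →ₗ[ℂ] AlgPow H n →ₗ⋆[ℂ] ℂ :=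
  PiTensorProduct.lift
    { toFun := fun x => (starLinearEquiv ℂ (A := ℂ)).toLinearMap.comp (pairing x)
      map_update_add' := by
        intro _ x i a b
        refine linearMap_ext fun y => ?_
        simp only [LinearMap.comp_apply, LinearMap.add_apply, LinearEquiv.coe_coe,
          starLinearEquiv_apply, star_pairing_tprod]
        convert! MultilinearMap.map_update_add _ x i a b
      map_update_smul' := by
        intro _ x i c a
        refine linearMap_ext fun y => ?_
        simp only [LinearMap.comp_apply, LinearMap.smul_apply, LinearEquiv.coe_coe,
          starLinearEquiv_apply, star_pairing_tprod]
        convert! MultilinearMap.map_update_smul _ x i c a }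

theorem form_tprod {n : ℕ} (x y : Fin n → H) :
    form n (tprod x) (tprod y) = ∏ i, ⟪y i, x i⟫_ℂ := by
  have : form n (tprod x) = (starLinearEquiv ℂ (A := ℂ)).toLinearMap.comp (pairing x) :=
    PiTensorProduct.lift.tprod _
  rw [this]
  simp only [LinearMap.comp_apply, LinearEquiv.coe_coe, starLinearEquiv_apply, star_pairing_tprod]
  simp

theorem mulEquiv_tprod {n m : ℕ} (x : Fin n → H) (y : Fin m → H) :
    mulEquiv n m (tprod x ⊗ₜ[ℂ] tprod y) = tprod (Fin.append x y) :=
  TensorPower.tprod_mul_tprod ℂ x y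

theorem map_tprod {n : ℕ} (C : H →ₗ[ℂ] H) (x : Fin n → H) :
    map n C (tprod x) = tprod (fun i => C (x i)) :=
  PiTensorProduct.map_tprod _ _

theorem form_conj_symm {n : ℕ} (u v : AlgPow H n) : conj (form n u v) = form n v u := by
  induction u using induction with
  | h1 c x =>
    induction v using induction with
    | h1 d y => simp [form_tprod, map_prod]; ring
    | h2 v w hv hw => simp only [map_add, LinearMap.add_apply, hv, hw]
  | h2 u w hu hw => simp only [map_add, LinearMap.add_apply, hu, hw]

/-- Inner product spaces structures on two tensor powers that are given by `form` induce the
form on the larger tensor power. -/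
theorem inner_eq_form_mulEquiv {n m : ℕ}
    (cn : InnerProductSpace.Core ℂ (AlgPow H n)) (cm : InnerProductSpace.Core ℂ (AlgPow H m))
    (hn : ∀ u v, cn.inner u v = form n v u) (hm : ∀ u v, cm.inner u v = form m v u)
    (s t : AlgPow H n ⊗[ℂ] AlgPow H m) :
    letI := cn.toNormedAddCommGroup
    letI : InnerProductSpace ℂ (AlgPow H n) := .ofCore cn.toCore
    letI := cm.toNormedAddCommGroup
    letI : InnerProductSpace ℂ (AlgPow H m) := .ofCore cm.toCore
    ⟪s, t⟫_ℂ = form (n + m) (mulEquiv n m t) (mulEquiv n m s) := by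
  let := cn.toNormedAddCommGroup
  let : InnerProductSpace ℂ (AlgPow H n) := .ofCore cn.toCore
  let := cm.toNormedAddCommGroup
  let : InnerProductSpace ℂ (AlgPow H m) := .ofCore cm.toCore
  have hn' : ∀ u v : AlgPow H n, ⟪u, v⟫_ℂ = form n v u := hn
  have hm' : ∀ u v : AlgPow H m, ⟪u, v⟫_ℂ = form m v u := hm
  have key : ∀ (a a' : AlgPow H n) (b b' : AlgPow H m), form n a' a * form m b' b =
      form (n + m) (mulEquiv n m (a' ⊗ₜ[ℂ] b')) (mulEquiv n m (a ⊗ₜ[ℂ] b)) := by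
    intro a a' b b'
    induction a using induction with
    | h2 u v hu hv => simp only [map_add, add_mul, hu, hv, TensorProduct.add_tmul]
    | h1 c x =>
      induction a' using induction with
      | h2 u v hu hv =>
        simp only [map_add, LinearMap.add_apply, add_mul, hu, hv, TensorProduct.add_tmul]
      | h1 d y =>
        induction b using induction with
        | h2 u v hu hv => simp only [map_add, mul_add, hu, hv, TensorProduct.tmul_add]
        | h1 e z =>
          induction b' using induction with
          | h2 u v hu hv =>
            simp only [map_add, LinearMap.add_apply, mul_add, hu, hv, TensorProduct.tmul_add]
          | h1 f w =>
            simp only [← TensorProduct.smul_tmul', TensorProduct.tmul_smul, map_smul,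
              LinearMap.smul_apply, map_smulₛₗ, mulEquiv_tprod, form_tprod, Fin.prod_univ_add,
              Fin.append_left, Fin.append_right, smul_eq_mul]
            ring
  induction s using TensorProduct.induction_on with
  | zero => simp
  | add s s' hs hs' => simp only [inner_add_left, map_add, hs, hs']
  | tmul a b =>
    induction t using TensorProduct.induction_on with
    | zero => simp
    | add t t' ht ht' => simp only [inner_add_right, map_add, LinearMap.add_apply, ht, ht']
    | tmul a' b' => rw [TensorProduct.inner_tmul, hn', hm', key]

theorem exists_eq_smul (u : AlgPow H 0) : ∃ c : ℂ, u = c • tprod Fin.elim0 := by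
  induction u using induction with
  | h1 c x => exact ⟨c, by rw [Subsingleton.elim x]⟩
  | h2 u v hu hv =>
    obtain ⟨c, rfl⟩ := hu
    obtain ⟨d, rfl⟩ := hv
    exact ⟨c + d, by rw [add_smul]⟩

theorem exists_eq_tprod (u : AlgPow H 1) : ∃ x : H, u = tprod fun _ => x := by
  refine ⟨PiTensorProduct.subsingletonEquiv (0 : Fin 1) u, ?_⟩
  refine ((PiTensorProduct.subsingletonEquiv (R := ℂ) (s := fun _ => H)
    (0 : Fin 1)).symm_apply_apply u).symm.trans ?_
  rw [PiTensorProduct.subsingletonEquiv_symm_apply, tprod]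
  congr 1
  funext i
  obtain rfl : i = 0 := Subsingleton.elim i 0
  simp

/-- The inner product space structure, from positivity and definiteness of the form. -/
abbrev coreOf {n : ℕ} (h0 : ∀ u : AlgPow H n, 0 ≤ (form n u u).re)
    (h1 : ∀ u : AlgPow H n, form n u u = 0 → u = 0) : InnerProductSpace.Core ℂ (AlgPow H n) where
  inner u v := form n v u
  conj_inner_symm u v := form_conj_symm u v
  re_inner_nonneg u := h0 u
  add_left u v w := by simp
  smul_left u v c := by simp
  definite u := h1 u

theorem form_pos_definite (n : ℕ) :
    (∀ u : AlgPow H n, 0 ≤ (form n u u).re) ∧ ∀ u : AlgPow H n, form n u u = 0 → u = 0 := by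
  induction n with
  | zero =>
    refine ⟨fun u => ?_, fun u hu => ?_⟩ <;> obtain ⟨c, rfl⟩ := exists_eq_smul u
    · have : 0 ≤ c.re * c.re + c.im * c.im := add_nonneg (mul_self_nonneg _) (mul_self_nonneg _)
      simpa [form_tprod] using this
    · simp [form_tprod] at hu
      simp [hu]
  | succ n ih =>
    have one : (∀ u : AlgPow H 1, 0 ≤ (form 1 u u).re) ∧
        ∀ u : AlgPow H 1, form 1 u u = 0 → u = 0 := by
      refine ⟨fun u => ?_, fun u hu => ?_⟩ <;> obtain ⟨x, rfl⟩ := exists_eq_tprod u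
      · simpa [form_tprod] using inner_self_nonneg (𝕜 := ℂ) (x := x)
      · have : x = 0 := by simpa [form_tprod] using hu
        subst this
        exact (PiTensorProduct.tprod ℂ).map_zero
    let cn := coreOf ih.1 ih.2
    let c1 := coreOf one.1 one.2
    have h := inner_eq_form_mulEquiv cn c1 (fun _ _ => rfl) (fun _ _ => rfl)
    let := cn.toNormedAddCommGroup
    let : InnerProductSpace ℂ (AlgPow H n) := .ofCore cn.toCore
    let := c1.toNormedAddCommGroup
    let : InnerProductSpace ℂ (AlgPow H 1) := .ofCore c1.toCore
    refine ⟨fun u => ?_, fun u hu => ?_⟩ <;>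
      obtain ⟨s, rfl⟩ := (mulEquiv n 1).surjective u
    · rw [← h s s]
      exact inner_self_nonneg (𝕜 := ℂ) (x := s)
    · rw [← h s s] at hu
      rw [(inner_self_eq_zero (𝕜 := ℂ) (x := s)).1 hu, map_zero]

/-- The inner product of the algebraic tensor power, with
`⟪x₀ ⊗ ⋯ ⊗ x₍ₙ₋₁₎, y₀ ⊗ ⋯ ⊗ y₍ₙ₋₁₎⟫ = ∏ i, ⟪xᵢ, yᵢ⟫`. -/
instance instCore (n : ℕ) : InnerProductSpace.Core ℂ (AlgPow H n) :=
  coreOf (form_pos_definite n).1 (form_pos_definite n).2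

instance (n : ℕ) : NormedAddCommGroup (AlgPow H n) := (instCore n).toNormedAddCommGroup

instance (n : ℕ) : InnerProductSpace ℂ (AlgPow H n) := .ofCore (instCore n).toCore

theorem inner_tprod {n : ℕ} (x y : Fin n → H) :
    ⟪tprod x, tprod y⟫_ℂ = ∏ i, ⟪x i, y i⟫_ℂ :=
  form_tprod y x

/-- Concatenation of tensors is isometric. -/
def mulIsometry (n m : ℕ) : AlgPow H n ⊗[ℂ] AlgPow H m ≃ₗᵢ[ℂ] AlgPow H (n + m) :=
  (mulEquiv n m).isometryOfInner fun s t =>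
    (inner_eq_form_mulEquiv (instCore n) (instCore m) (fun _ _ => rfl) (fun _ _ => rfl) s t).symm

theorem mulIsometry_tprod {n m : ℕ} (x : Fin n → H) (y : Fin m → H) :
    mulIsometry n m (tprod x ⊗ₜ[ℂ] tprod y) = tprod (Fin.append x y) :=
  mulEquiv_tprod x y


theorem map_bounded (C : H →L[ℂ] H) (n : ℕ) :
    ∃ c : ℝ, ∀ u : AlgPow H n, ‖map n (C : H →ₗ[ℂ] H) u‖ ≤ c * ‖u‖ := by
  induction n with
  | zero =>
    refine ⟨1, fun u => ?_⟩
    obtain ⟨c, rfl⟩ := exists_eq_smul u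
    rw [map_smul, map_tprod, one_mul]
    apply le_of_eq
    congr 3
    exact Subsingleton.elim _ _
  | succ n ih =>
    have one : ∃ c : ℝ, ∀ u : AlgPow H 1, ‖map 1 (C : H →ₗ[ℂ] H) u‖ ≤ c * ‖u‖ := by
      have hnorm : ∀ x : H, ‖(tprod fun _ => x : AlgPow H 1)‖ = ‖x‖ := fun x => by
        rw [norm_eq_sqrt_re_inner (𝕜 := ℂ), norm_eq_sqrt_re_inner (𝕜 := ℂ) x, inner_tprod]
        simp
      refine ⟨‖C‖, fun u => ?_⟩
      obtain ⟨x, rfl⟩ := exists_eq_tprod u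
      rw [map_tprod, hnorm, ContinuousLinearMap.coe_coe, hnorm]
      exact C.le_opNorm x
    let f := (map n (C : H →ₗ[ℂ] H)).mkContinuousOfExistsBound ih
    let g := (map 1 (C : H →ₗ[ℂ] H)).mkContinuousOfExistsBound one
    have key : ∀ s, map (n + 1) (C : H →ₗ[ℂ] H) (mulIsometry n 1 s) =
        mulIsometry n 1 (TensorProduct.mapL f g s) := by
      intro s
      induction s using TensorProduct.induction_on with
      | zero => simp
      | add s t hs ht => simp only [map_add, hs, ht]
      | tmul a b =>
        rw [TensorProduct.mapL_tmul]
        change _ = mulIsometry n 1 (map n (C : H →ₗ[ℂ] H) a ⊗ₜ[ℂ] map 1 (C : H →ₗ[ℂ] H) b)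
        obtain ⟨y, rfl⟩ := exists_eq_tprod b
        induction a using induction with
        | h2 u v hu hv => simp only [map_add, hu, hv, TensorProduct.add_tmul]
        | h1 c x =>
          simp only [← TensorProduct.smul_tmul', map_smul, mulIsometry_tprod, map_tprod]
          congr 2
          funext i
          refine Fin.addCases (fun i => ?_) (fun i => ?_) i
          · simp only [Fin.append_left]
          · simp only [Fin.append_right]
    refine ⟨‖TensorProduct.mapL f g‖, fun u => ?_⟩
    obtain ⟨s, rfl⟩ := (mulIsometry n 1).surjective u
    rw [key, LinearIsometryEquiv.norm_map, LinearIsometryEquiv.norm_map]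
    exact ContinuousLinearMap.le_opNorm _ _

/-- The algebraic tensor power of a bounded operator, as a bounded operator. -/
def mapL (n : ℕ) (C : H →L[ℂ] H) : AlgPow H n →L[ℂ] AlgPow H n :=
  (map n (C : H →ₗ[ℂ] H)).mkContinuousOfExistsBound (map_bounded C n)

end AlgPow

variable (H) in
/-- The `n`-th tensor power `H^{⊗n}` of a Hilbert space: the completion of the algebraic one. -/
abbrev HilbertPow (n : ℕ) : Type _ := UniformSpace.Completion (AlgPow H n)

namespace HilbertPow

open UniformSpace.Completion

/-- The elementary tensor `x₀ ⊗ ⋯ ⊗ x₍ₙ₋₁₎` in `H^{⊗n}`. -/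
def tprod {n : ℕ} (x : Fin n → H) : HilbertPow H n := (AlgPow.tprod x : AlgPow H n)

theorem inner_tprod {n : ℕ} (x y : Fin n → H) :
    ⟪tprod x, tprod y⟫_ℂ = ∏ i, ⟪x i, y i⟫_ℂ := by
  rw [tprod, tprod, inner_coe, AlgPow.inner_tprod]

/-- The tensor power `C^{⊗n}` of a bounded operator: the continuous extension to `H^{⊗n}` of the
algebraic tensor power. -/
def opPow (C : H →L[ℂ] H) (n : ℕ) : HilbertPow H n →L[ℂ] HilbertPow H n :=
  (toComplL ∘L AlgPow.mapL n C).extend toComplL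

theorem isUniformInducing_toComplL (n : ℕ) :
    IsUniformInducing (toComplL (𝕜 := ℂ) (E := AlgPow H n)) :=
  UniformSpace.Completion.isUniformInducing_coe _

theorem denseRange_toComplL (n : ℕ) : DenseRange (toComplL (𝕜 := ℂ) (E := AlgPow H n)) :=
  UniformSpace.Completion.denseRange_coe

theorem opPow_tprod (C : H →L[ℂ] H) {n : ℕ} (x : Fin n → H) :
    opPow C n (tprod x) = tprod fun i => C (x i) := by
  refine (ContinuousLinearMap.extend_eq _ (denseRange_toComplL n)
    (isUniformInducing_toComplL n) (AlgPow.tprod x)).trans ?_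
  exact congrArg (fun u : AlgPow H n => (u : HilbertPow H n))
    (AlgPow.map_tprod (C : H →ₗ[ℂ] H) x)

/-- The inclusion of the algebraic tensor product of the algebraic powers into the algebraic
tensor product of the completed powers. -/
def incl (n m : ℕ) :
    AlgPow H n ⊗[ℂ] AlgPow H m →ₗᵢ[ℂ] HilbertPow H n ⊗[ℂ] HilbertPow H m :=
  TensorProduct.mapIsometry (toComplₗᵢ (𝕜 := ℂ) (E := AlgPow H n))
    (toComplₗᵢ (𝕜 := ℂ) (E := AlgPow H m))

theorem denseRange_incl (n m : ℕ) : DenseRange (incl (H := H) n m).toContinuousLinearMap := by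
  have hcl : ∀ w : HilbertPow H n ⊗[ℂ] HilbertPow H m,
      w ∈ (LinearMap.range (incl (H := H) n m).toLinearMap).topologicalClosure := by
    intro w
    induction w using TensorProduct.induction_on with
    | zero => exact zero_mem _
    | add s t hs ht => exact add_mem hs ht
    | tmul a b =>
      have h : ∀ (a : HilbertPow H n) (b : HilbertPow H m), a ⊗ₜ[ℂ] b ∈
          (LinearMap.range (incl (H := H) n m).toLinearMap).topologicalClosure := by
        intro a b
        induction a, b using UniformSpace.Completion.induction_on₂ with
        | hp =>
          exact (Submodule.isClosed_topologicalClosure _).preimage TensorProduct.continuous_tmul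
        | ih a b => exact subset_closure ⟨a ⊗ₜ[ℂ] b, rfl⟩
      exact h a b
  exact fun w => hcl w

theorem isUniformInducing_incl (n m : ℕ) :
    IsUniformInducing (incl (H := H) n m).toContinuousLinearMap :=
  (incl (H := H) n m).isometry.isUniformInducing

/-- The concatenation map `u ⊗ v ↦ u ⊗ v` from `H^{⊗n} ⊗ H^{⊗m}` to `H^{⊗(n+m)}`, the continuous
extension of the algebraic one. -/
def concat (n m : ℕ) : HilbertPow H n ⊗[ℂ] HilbertPow H m →L[ℂ] HilbertPow H (n + m) :=
  (toComplL ∘L ((AlgPow.mulIsometry n m).toLinearIsometry.toContinuousLinearMap :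
      AlgPow H n ⊗[ℂ] AlgPow H m →L[ℂ] AlgPow H (n + m))).extend
    (incl n m).toContinuousLinearMap

theorem concat_incl (n m : ℕ) (s : AlgPow H n ⊗[ℂ] AlgPow H m) :
    concat n m (incl n m s) = (AlgPow.mulIsometry n m s : HilbertPow H (n + m)) :=
  ContinuousLinearMap.extend_eq _ (denseRange_incl n m) (isUniformInducing_incl n m) s

theorem concat_tprod {n m : ℕ} (x : Fin n → H) (y : Fin m → H) :
    concat n m (tprod x ⊗ₜ[ℂ] tprod y) = tprod (Fin.append x y) := by
  refine (concat_incl n m (AlgPow.tprod x ⊗ₜ[ℂ] AlgPow.tprod y)).trans ?_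
  rw [AlgPow.mulIsometry_tprod, tprod]

/-- The tensor product `X₁ ⊗ X₂` of bounded operators on `H^{⊗n}` and `H^{⊗m}`, as a bounded
operator on `H^{⊗(n+m)}`. -/
def opTensor {n m : ℕ} (X₁ : HilbertPow H n →L[ℂ] HilbertPow H n)
    (X₂ : HilbertPow H m →L[ℂ] HilbertPow H m) :
    HilbertPow H (n + m) →L[ℂ] HilbertPow H (n + m) :=
  (concat n m ∘L TensorProduct.mapL X₁ X₂ ∘L (incl n m).toContinuousLinearMap ∘L
    ((AlgPow.mulIsometry n m).symm.toLinearIsometry.toContinuousLinearMap :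
      AlgPow H (n + m) →L[ℂ] AlgPow H n ⊗[ℂ] AlgPow H m)).extend toComplL

/-- The defining property `(X₁ ⊗ X₂) (u ⊗ v) = X₁ u ⊗ X₂ v`. -/
theorem opTensor_concat {n m : ℕ} (X₁ : HilbertPow H n →L[ℂ] HilbertPow H n)
    (X₂ : HilbertPow H m →L[ℂ] HilbertPow H m) (u : HilbertPow H n) (v : HilbertPow H m) :
    opTensor X₁ X₂ (concat n m (u ⊗ₜ[ℂ] v)) = concat n m (X₁ u ⊗ₜ[ℂ] X₂ v) := by
  have h : ∀ w, opTensor X₁ X₂ (concat n m w) = concat n m (TensorProduct.mapL X₁ X₂ w) := by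
    refine fun w => (denseRange_incl n m).induction_on w
      (isClosed_eq (by fun_prop) (by fun_prop)) fun s => ?_
    refine (congrArg _ (concat_incl n m s)).trans ?_
    refine (ContinuousLinearMap.extend_eq _ (denseRange_toComplL _)
      (isUniformInducing_toComplL _) (AlgPow.mulIsometry n m s)).trans ?_
    simp
  exact h _

end HilbertPow

end TensorPowers

/-! ### Trace-class operators and the trace -/

section Trace

variable {E : Type*} [NormedAddCommGroup E] [InnerProductSpace ℂ E] [CompleteSpace E]

variable (E) in
/-- A (fixed, arbitrary) orthonormal basis of a Hilbert space. -/
def someHilbertBasis : HilbertBasis (exists_hilbertBasis ℂ E).choose ℂ E :=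
  (exists_hilbertBasis ℂ E).choose_spec.choose

/-- `T` is trace-class: `Tr |T| = ∑ i, ⟪eᵢ, |T| eᵢ⟫ < ∞`, where `|T| = (T⋆ T)^{1/2}`.  (All terms
are nonnegative, so that summability means that the sum is finite; the choice of the orthonormal
basis does not matter.) -/
def IsTraceClass (T : E →L[ℂ] E) : Prop :=
  Summable fun i => (⟪someHilbertBasis E i, CFC.abs T (someHilbertBasis E i)⟫_ℂ).re

/-- The trace `Tr T = ∑ i, ⟪eᵢ, T eᵢ⟫` of a trace-class operator. -/
def opTrace (T : E →L[ℂ] E) : ℂ :=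
  ∑' i, ⟪someHilbertBasis E i, T (someHilbertBasis E i)⟫_ℂ

/-- The trace `Tr A X`, as an element of `[0, ∞]`, for positive semi-definite `A`, `X` with `A X`
trace-class.  (Then `Tr A X` is a nonnegative real number.) -/
def trMul (A X : E →L[ℂ] E) : ℝ≥0∞ := ENNReal.ofReal (opTrace (A * X)).re

end Trace

/-! ### Integrals of extended real valued functions -/

/-- The integral `∫ f⁺ dμ - ∫ f⁻ dμ` of a function with values in `[-∞, ∞]`. -/
def erealIntegral {Y : Type*} [MeasurableSpace Y] (μ : MeasureTheory.Measure Y) (f : Y → EReal) :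
    EReal :=
  ((∫⁻ y, (f y).toENNReal ∂μ : ℝ≥0∞) : EReal) - ((∫⁻ y, (-f y).toENNReal ∂μ : ℝ≥0∞) : EReal)

/-! ### The bounds -/

section Bounds

open HilbertPow MeasureTheory

variable {H : Type*} [NormedAddCommGroup H] [InnerProductSpace ℂ H]
  {Y : Type*} (A : Y → H →L[ℂ] H) (C : H →L[ℂ] H)
  (X : (n : ℕ) → Set (HilbertPow H n →L[ℂ] HilbertPow H n)) (n : ℕ)

/-- `Tr C^{⊗n} x ≤ exp (∫ log Tr A_y^{⊗n} x dν(y))` for all `x ∈ X n`, with `log 0 = -∞`,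
`exp (-∞) = 0`. -/
def GeometricBound [MeasurableSpace Y] (ν : Measure Y) : Prop :=
  ∀ x ∈ X n, trMul (opPow C n) x ≤
    EReal.exp (erealIntegral ν fun y => ENNReal.log (trMul (opPow (A y) n) x))

/-- `Tr C^{⊗n} x ≤ ∫ Tr A_y^{⊗n} x dμ(y)` for all `x ∈ X n`. -/
def ArithmeticBound [MeasurableSpace Y] (μ : Measure Y) : Prop :=
  ∀ x ∈ X n, trMul (opPow C n) x ≤ ∫⁻ y, trMul (opPow (A y) n) x ∂μ

/-- `Tr C^{⊗n} x ≤ sup_y Tr A_y^{⊗n} x` for all `x ∈ X n`. -/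
def SupBound : Prop :=
  ∀ x ∈ X n, trMul (opPow C n) x ≤ ⨆ y, trMul (opPow (A y) n) x

end Bounds

end

open HilbertPow MeasureTheory Filter

/-! ### Hilbert–Schmidt operators -/

section HilbertSchmidt

variable {E : Type*} [NormedAddCommGroup E] [InnerProductSpace ℂ E]

/-! Two facts about traces turn the theorem into one about nonnegative continuous functions on a
compact space. First, `Tr A^{⊗n} X` is real and nonnegative for positive `A`, `X`
(`opTrace_mul_nonneg`); this needs an argument because only the product is trace-class. Second, the
trace is multiplicative: `X₁ ⊗ X₂` yields the product of the two traces
(`opTrace_opPow_mul_opTensor`). So the pairs `(n, X)` index functions `f y = Tr A_y^{⊗n} X` and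
numbers `c = Tr C^{⊗n} X`, closed under simultaneous products, with the degrees `n` adding.

From (iv), applying the bound to the powers `X^{⊗k}` and taking roots removes the subexponential
masses, so `c ≤ max f` for every pair (`exists_le_of_limsup_log_le`). This is (v).

The pointwise bound gives (i) by duality. By multiplicativity, the functions `log f - log c` are
closed under addition, and none is strictly negative everywhere. Hahn–Banach separates the cone they
generate from the open cone of strictly negative functions, and Riesz representation turns the
separating functional into a probability measure `ν` with `∫ log f dν ≥ log c`
(`exists_probabilityMeasure_log_le_integral`). Zeros of `f` are handled by truncating at `exp (-k)`
and monotone convergence. Jensen's inequality gives (i) ⇒ (iii) and (ii) ⇒ (iv); the other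
implications are immediate. -/

theorem HilbertBasis.hasSum_norm_inner_sq {ι : Type*} (b : HilbertBasis ι ℂ E) (x : E) :
    HasSum (fun i => ‖⟪b i, x⟫_ℂ‖ ^ 2) (‖x‖ ^ 2) := by
  have h := (b.hasSum_inner_mul_inner x x).mapL Complex.reCLM
  rw [inner_self_eq_norm_sq_to_K] at h
  convert h using 1
  · funext i
    rw [← inner_conj_symm x (b i), mul_comm, RCLike.mul_conj]
    simp [← Complex.ofReal_pow]
  · simp [← Complex.ofReal_pow]

theorem summable_prod_norm_inner_sq {ι κ : Type*} {b : HilbertBasis ι ℂ E}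
    (f : HilbertBasis κ ℂ E) {T : E →L[ℂ] E} (h : Summable fun i => ‖T (b i)‖ ^ 2) :
    Summable fun p : ι × κ => ‖⟪f p.2, T (b p.1)⟫_ℂ‖ ^ 2 := by
  refine (summable_prod_of_nonneg (f := fun p : ι × κ => ‖⟪f p.2, T (b p.1)⟫_ℂ‖ ^ 2)
    fun p => sq_nonneg _).2 ⟨fun i => (f.hasSum_norm_inner_sq (T (b i))).summable, ?_⟩
  exact h.congr fun i => (f.hasSum_norm_inner_sq (T (b i))).tsum_eq.symm

variable [CompleteSpace E]

/-- The operator `T` is Hilbert–Schmidt: `∑ i, ‖T eᵢ‖² < ∞`. -/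
def IsHilbertSchmidt (T : E →L[ℂ] E) : Prop :=
  Summable fun i => ‖T (someHilbertBasis E i)‖ ^ 2

/-- The double series of `|⟪f j, T (b i)⟫|²` is summed by rows for `T` and by columns for its
adjoint. Since `f` is arbitrary, passing to the adjoint also changes the basis. -/
theorem summable_norm_adjoint_sq {ι κ : Type*} {b : HilbertBasis ι ℂ E}
    (f : HilbertBasis κ ℂ E) {T : E →L[ℂ] E} (h : Summable fun i => ‖T (b i)‖ ^ 2) :
    Summable fun j => ‖T.adjoint (f j)‖ ^ 2 := by
  have h1 := ((summable_prod_of_nonneg fun p => sq_nonneg _).1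
    (summable_prod_norm_inner_sq f h).prod_symm).2
  refine h1.congr fun j => ?_
  rw [← (b.hasSum_norm_inner_sq (T.adjoint (f j))).tsum_eq]
  refine tsum_congr fun i => ?_
  rw [ContinuousLinearMap.adjoint_inner_right, ← inner_conj_symm, RCLike.norm_conj]
  rfl

namespace IsHilbertSchmidt

variable {T S : E →L[ℂ] E}

theorem adjoint (h : IsHilbertSchmidt T) : IsHilbertSchmidt T.adjoint :=
  summable_norm_adjoint_sq _ h

theorem summable {ι : Type*} (h : IsHilbertSchmidt T) (b : HilbertBasis ι ℂ E) :
    Summable fun i => ‖T (b i)‖ ^ 2 := by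
  simpa using summable_norm_adjoint_sq b h.adjoint

theorem mul_left (h : IsHilbertSchmidt T) (B : E →L[ℂ] E) : IsHilbertSchmidt (B * T) := by
  refine Summable.of_nonneg_of_le (fun _ => by positivity) (fun i => ?_)
    (Summable.mul_left (‖B‖ ^ 2) h)
  rw [← mul_pow]
  gcongr
  exact B.le_opNorm _

theorem mul_right (h : IsHilbertSchmidt T) (B : E →L[ℂ] E) : IsHilbertSchmidt (T * B) := by
  have := (h.adjoint.mul_left B.adjoint).adjoint
  rwa [← ContinuousLinearMap.star_eq_adjoint, ← ContinuousLinearMap.star_eq_adjoint,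
    ← ContinuousLinearMap.star_eq_adjoint, star_mul, star_star, star_star] at this

theorem summable_prod {ι κ : Type*} (hT : IsHilbertSchmidt T) (hS : IsHilbertSchmidt S)
    (b : HilbertBasis ι ℂ E) (f : HilbertBasis κ ℂ E) :
    Summable fun p : ι × κ => ⟪b p.1, T (f p.2)⟫_ℂ * ⟪f p.2, S (b p.1)⟫_ℂ := by
  have h1 := summable_prod_norm_inner_sq f (hS.summable b)
  have h2 := (summable_prod_norm_inner_sq b (hT.summable f)).prod_symm
  refine Summable.of_norm_bounded (h1.add h2) fun p => ?_
  rw [norm_mul]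
  simp only [Prod.swap]
  nlinarith [sq_nonneg (‖⟪b p.1, T (f p.2)⟫_ℂ‖ - ‖⟪f p.2, S (b p.1)⟫_ℂ‖),
    sq_nonneg (‖⟪b p.1, T (f p.2)⟫_ℂ‖), sq_nonneg (‖⟪f p.2, S (b p.1)⟫_ℂ‖)]

theorem hasSum_inner_mul {κ : Type*} (f : HilbertBasis κ ℂ E) (x y : E) :
    HasSum (fun j => ⟪x, T (f j)⟫_ℂ * ⟪f j, S y⟫_ℂ) ⟪x, (T * S) y⟫_ℂ := by
  have := f.hasSum_inner_mul_inner (T.adjoint x) (S y)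
  simp only [ContinuousLinearMap.adjoint_inner_left] at this
  exact this

theorem summable_inner_mul {ι : Type*} (hT : IsHilbertSchmidt T) (hS : IsHilbertSchmidt S)
    (b : HilbertBasis ι ℂ E) : Summable fun i => ⟪b i, (T * S) (b i)⟫_ℂ :=
  (hT.summable_prod hS b b).prod.congr fun i => (hasSum_inner_mul b (b i) (b i)).tsum_eq

/-- Fubini for the absolutely summable double series of matrix entries. Allowing two different bases
makes this the source of both cyclicity and basis independence. -/
theorem tsum_inner_mul_comm {ι κ : Type*} (hT : IsHilbertSchmidt T) (hS : IsHilbertSchmidt S)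
    (b : HilbertBasis ι ℂ E) (f : HilbertBasis κ ℂ E) :
    ∑' i, ⟪b i, (T * S) (b i)⟫_ℂ = ∑' j, ⟪f j, (S * T) (f j)⟫_ℂ := by
  calc _ = ∑' i, ∑' j, ⟪b i, T (f j)⟫_ℂ * ⟪f j, S (b i)⟫_ℂ :=
        tsum_congr fun i => (hasSum_inner_mul f (b i) (b i)).tsum_eq.symm
    _ = ∑' j, ∑' i, ⟪b i, T (f j)⟫_ℂ * ⟪f j, S (b i)⟫_ℂ :=
        (Summable.tsum_comm (f := fun i j => ⟪b i, T (f j)⟫_ℂ * ⟪f j, S (b i)⟫_ℂ)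
          (hT.summable_prod hS b f)).symm
    _ = _ := tsum_congr fun j => by
        rw [← (hasSum_inner_mul b (f j) (f j)).tsum_eq]
        exact tsum_congr fun i => mul_comm _ _

theorem opTrace_mul_comm (hT : IsHilbertSchmidt T) (hS : IsHilbertSchmidt S) :
    opTrace (T * S) = opTrace (S * T) :=
  hT.tsum_inner_mul_comm hS _ _

end IsHilbertSchmidt

/-! ### Trace-class operators -/

/-- Douglas' lemma. -/
theorem ContinuousLinearMap.exists_eq_mul_of_norm_le {T D : E →L[ℂ] E}
    (h : ∀ x, ‖T x‖ ≤ ‖D x‖) : ∃ U : E →L[ℂ] E, T = U * D := by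
  let K := (LinearMap.range (D : E →ₗ[ℂ] E)).topologicalClosure
  have : CompleteSpace K := (Submodule.isClosed_topologicalClosure _).completeSpace_coe
  let e : E →ₗ[ℂ] K := (D : E →ₗ[ℂ] E).codRestrict K
    fun x => Submodule.le_topologicalClosure _ ⟨x, rfl⟩
  have he : DenseRange e := by
    rintro ⟨x, hx⟩
    rw [Metric.mem_closure_iff]
    intro ε hε
    obtain ⟨_, ⟨y, rfl⟩, hy⟩ := Metric.mem_closure_iff.1 hx ε hε
    exact ⟨e y, ⟨y, rfl⟩, hy⟩
  -- `U` sends `D x` to `T x`, which is contractive on the range of `D`; it is extended to the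
  -- closure and set to zero on the orthogonal complement.
  refine ⟨((T : E →ₗ[ℂ] E).extendOfNorm e) ∘L K.orthogonalProjectionOnto, ?_⟩
  ext x
  have h1 : K.orthogonalProjectionOnto (D x) = e x :=
    Submodule.orthogonalProjectionOnto_mem_subspace_eq_self (e x)
  change T x = (T : E →ₗ[ℂ] E).extendOfNorm e (K.orthogonalProjectionOnto (D x))
  rw [h1, LinearMap.extendOfNorm_eq he ⟨1, fun x => (h x).trans (one_mul _).ge⟩]
  rfl

theorem norm_cfcAbs_apply (T : E →L[ℂ] E) (x : E) : ‖CFC.abs T x‖ = ‖T x‖ := by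
  have hD : (CFC.abs T).adjoint = CFC.abs T := (CFC.abs_nonneg T).isSelfAdjoint
  have h : ⟪CFC.abs T x, CFC.abs T x⟫_ℂ = ⟪T x, T x⟫_ℂ := by
    have h1 := congrArg (fun S : E →L[ℂ] E => ⟪x, S x⟫_ℂ) (CFC.abs_mul_abs T)
    simp only [mul_apply_eq_comp, ContinuousLinearMap.star_eq_adjoint,
      ContinuousLinearMap.adjoint_inner_right] at h1
    rw [← h1, ← ContinuousLinearMap.adjoint_inner_right, hD]
  rw [norm_eq_sqrt_re_inner (𝕜 := ℂ), h, ← norm_eq_sqrt_re_inner]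

namespace IsTraceClass

variable {T : E →L[ℂ] E}

theorem isHilbertSchmidt_sqrt (h : IsTraceClass T) :
    IsHilbertSchmidt (CFC.sqrt (CFC.abs T)) := by
  refine h.congr fun i => ?_
  have hR : (CFC.sqrt (CFC.abs T)).adjoint = CFC.sqrt (CFC.abs T) :=
    (CFC.sqrt_nonneg _).isSelfAdjoint
  conv_lhs => rw [← CFC.sqrt_mul_sqrt_self (CFC.abs T) (CFC.abs_nonneg T)]
  rw [mul_apply_eq_comp, ← ContinuousLinearMap.adjoint_inner_left, hR]
  exact inner_self_eq_norm_sq (𝕜 := ℂ) _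

/-- Douglas' lemma applied to `‖T x‖ = ‖|T| x‖` gives `T = U |T|`, so `V = U |T|^{1/2}`. This
reduces facts about trace-class operators to products of two Hilbert–Schmidt operators. -/
theorem exists_eq_mul_sqrt (h : IsTraceClass T) :
    ∃ V, IsHilbertSchmidt V ∧ T = V * CFC.sqrt (CFC.abs T) := by
  obtain ⟨U, hU⟩ := ContinuousLinearMap.exists_eq_mul_of_norm_le
    (fun x => (norm_cfcAbs_apply T x).ge)
  refine ⟨U * CFC.sqrt (CFC.abs T), h.isHilbertSchmidt_sqrt.mul_left U, ?_⟩
  rw [mul_assoc, CFC.sqrt_mul_sqrt_self (CFC.abs T) (CFC.abs_nonneg T), ← hU]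

theorem summable_inner {ι : Type*} (h : IsTraceClass T) (b : HilbertBasis ι ℂ E) :
    Summable fun i => ⟪b i, T (b i)⟫_ℂ := by
  obtain ⟨V, hV, hT⟩ := h.exists_eq_mul_sqrt
  rw [hT]
  exact hV.summable_inner_mul h.isHilbertSchmidt_sqrt b

/-- The trace does not depend on the orthonormal basis. -/
theorem opTrace_eq_tsum {ι : Type*} (h : IsTraceClass T) (b : HilbertBasis ι ℂ E) :
    opTrace T = ∑' i, ⟪b i, T (b i)⟫_ℂ := by
  obtain ⟨V, hV, hT⟩ := h.exists_eq_mul_sqrt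
  have hW := h.isHilbertSchmidt_sqrt
  -- The factors are swapped twice: once changing the basis to `b`, once back within `b`.
  rw [hT, opTrace, hV.tsum_inner_mul_comm hW _ b, hW.tsum_inner_mul_comm hV b b]

end IsTraceClass

end HilbertSchmidt

/-! ### Positivity of the trace of a product of positive operators -/

section TracePositivity

variable {E : Type*} [NormedAddCommGroup E] [InnerProductSpace ℂ E] [CompleteSpace E]

namespace IsTraceClass

variable {T : E →L[ℂ] E}

/-- Cyclicity of the trace. -/
theorem opTrace_mul_mul_comm (h : IsTraceClass T) (B B' : E →L[ℂ] E) :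
    opTrace (T * B * B') = opTrace (B' * T * B) := by
  obtain ⟨V, hV, hT⟩ := h.exists_eq_mul_sqrt
  have hW := h.isHilbertSchmidt_sqrt
  set W := CFC.sqrt (CFC.abs T)
  have h1 := (hV.mul_left B').opTrace_mul_comm (hW.mul_right B)
  have h2 := hV.opTrace_mul_comm ((hW.mul_right B).mul_right B')
  rw [hT]
  simp only [mul_assoc] at h1 h2 ⊢
  rw [h1, h2]

theorem opTrace_sub_mul (h : IsTraceClass T) (B : E →L[ℂ] E) :
    opTrace (T - T * B) = opTrace T - opTrace (T * B) := by
  obtain ⟨V, hV, hT⟩ := h.exists_eq_mul_sqrt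
  have hW := h.isHilbertSchmidt_sqrt
  have h1 := hV.summable_inner_mul (hW.mul_right B) (someHilbertBasis E)
  rw [← mul_assoc, ← hT] at h1
  rw [opTrace, opTrace, opTrace, ← (h.summable_inner (someHilbertBasis E)).tsum_sub h1]
  exact tsum_congr fun i => by rw [sub_apply, inner_sub_right]

/-- The trace of `T * K j` tends to `0` if `T * K j` tends to `0` in norm and the `K j` are
uniformly bounded. -/
theorem tendsto_opTrace_mul (h : IsTraceClass T) (K : ℕ → E →L[ℂ] E) {c : ℝ}
    (hK : ∀ j, ‖K j‖ ≤ c) (hTK : Tendsto (fun j => T * K j) atTop (nhds 0)) :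
    Tendsto (fun j => opTrace (T * K j)) atTop (nhds 0) := by
  obtain ⟨V, hV, hT⟩ := h.exists_eq_mul_sqrt
  have hW := h.isHilbertSchmidt_sqrt
  have hWW := CFC.sqrt_mul_sqrt_self (CFC.abs T) (CFC.abs_nonneg T)
  have hWs : star (CFC.sqrt (CFC.abs T)) = CFC.sqrt (CFC.abs T) :=
    (CFC.sqrt_nonneg _).isSelfAdjoint
  set W := CFC.sqrt (CFC.abs T)
  have hWK : Tendsto (fun j => W * K j) atTop (nhds 0) := by
    -- The C⋆-identity gives `‖W K‖² = ‖K⋆ |T| K‖`, and `‖|T| K x‖ = ‖T K x‖`.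
    have h1 : ∀ j, ‖W * K j‖ ^ 2 ≤ c * ‖T * K j‖ := fun j => by
      have h2 : ‖CFC.abs T * K j‖ ≤ ‖T * K j‖ :=
        ContinuousLinearMap.opNorm_le_bound _ (norm_nonneg _) fun x =>
          (norm_cfcAbs_apply T (K j x)).le.trans ((T * K j).le_opNorm x)
      calc ‖W * K j‖ ^ 2 = ‖star (K j) * (CFC.abs T * K j)‖ := by
            rw [pow_two, ← CStarRing.norm_star_mul_self, star_mul, hWs, ← hWW]
            simp only [mul_assoc]
        _ ≤ ‖star (K j)‖ * ‖CFC.abs T * K j‖ := norm_mul_le _ _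
        _ ≤ c * ‖T * K j‖ := by
            rw [norm_star]
            exact mul_le_mul (hK j) h2 (norm_nonneg _) ((norm_nonneg _).trans (hK j))
    have h3 : Tendsto (fun j => c * ‖T * K j‖) atTop (nhds 0) := by
      simpa using hTK.norm.const_mul c
    have h4 : Tendsto (fun j => ‖W * K j‖ ^ 2) atTop (nhds 0) :=
      squeeze_zero (fun j => sq_nonneg _) h1 h3
    rw [tendsto_zero_iff_norm_tendsto_zero]
    simpa using h4.sqrt
  -- By cyclicity the trace is that of `(W K) V`. Each term then tends to zero and is dominated by
  -- `c ‖W eᵢ‖ ‖V eᵢ‖`, which is summable.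
  have hform : ∀ j, opTrace (T * K j) =
      ∑' i, ⟪star (W * K j) (someHilbertBasis E i), V (someHilbertBasis E i)⟫_ℂ := fun j => by
    rw [hT, mul_assoc, hV.opTrace_mul_comm (hW.mul_right (K j)), opTrace]
    refine tsum_congr fun i => ?_
    rw [ContinuousLinearMap.star_eq_adjoint, ContinuousLinearMap.adjoint_inner_left]
    rfl
  simp only [hform]
  have hlim : Tendsto (fun j => ∑' i, ⟪star (W * K j) (someHilbertBasis E i),
      V (someHilbertBasis E i)⟫_ℂ) atTop
      (nhds (∑' i, ⟪(0 : E →L[ℂ] E) (someHilbertBasis E i), V (someHilbertBasis E i)⟫_ℂ)) := by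
    refine tendsto_tsum_of_dominated_convergence
      (bound := fun i => c * (‖W (someHilbertBasis E i)‖ ^ 2 + ‖V (someHilbertBasis E i)‖ ^ 2))
      (Summable.mul_left _ (hW.add hV)) (fun i => ?_) (Eventually.of_forall fun j i => ?_)
    · have h1 : Tendsto (fun j => star (W * K j)) atTop (nhds 0) := by
        rw [← star_zero (E →L[ℂ] E)]
        exact (continuous_star.tendsto _).comp hWK
      exact ((ContinuousLinearMap.apply ℂ E (someHilbertBasis E i)).continuous.tendsto _ |>.comp
        h1).inner tendsto_const_nhds
    · set w := W (someHilbertBasis E i) with hw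
      set v := V (someHilbertBasis E i) with hv
      have h1 : ‖star (W * K j) (someHilbertBasis E i)‖ ≤ c * ‖w‖ := by
        rw [star_mul, hWs]
        refine ((star (K j)).le_opNorm w).trans ?_
        rw [norm_star]
        exact mul_le_mul_of_nonneg_right (hK j) (norm_nonneg _)
      have hc : 0 ≤ c := (norm_nonneg _).trans (hK j)
      calc _ ≤ ‖star (W * K j) (someHilbertBasis E i)‖ * ‖v‖ := norm_inner_le_norm _ _
        _ ≤ c * ‖w‖ * ‖v‖ := mul_le_mul_of_nonneg_right h1 (norm_nonneg _)
        _ = c * (‖w‖ * ‖v‖) := mul_assoc _ _ _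
        _ ≤ _ := by
          gcongr
          nlinarith [sq_nonneg (‖w‖ - ‖v‖), sq_nonneg ‖w‖, sq_nonneg ‖v‖]
  simpa using hlim

end IsTraceClass

open scoped ComplexOrder

theorem opTrace_nonneg {T : E →L[ℂ] E} (hT : T.IsPositive) : 0 ≤ opTrace T :=
  tsum_nonneg fun _ => hT.inner_nonneg_right _

/-- Formally `Tr A X = Tr X^{1/2} A X^{1/2}`, but cyclicity is available only around the trace-class
operator `A X`. With `P = (X + ε)^{-1/2}` and `K = ε (X + ε)⁻¹`, one has `A X P (X P) = A X - A X
K`, whose trace equals that of the positive operator `(X P) A (X P)`. As `ε → 0`, `‖X K‖ ≤ ε` and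
`‖K‖ ≤ 1` make `Tr A X K` vanish. -/
theorem opTrace_mul_nonneg {A X : E →L[ℂ] E} (hA : A.IsPositive) (hX : X.IsPositive)
    (h : IsTraceClass (A * X)) : 0 ≤ opTrace (A * X) := by
  have hX0 : 0 ≤ X := (ContinuousLinearMap.nonneg_iff_isPositive X).2 hX
  have hXs : IsSelfAdjoint X := hX0.isSelfAdjoint
  have hspec : ∀ t ∈ spectrum ℝ X, 0 ≤ t := fun t ht => spectrum_nonneg_of_nonneg hX0 ht
  let ε : ℕ → ℝ := fun j => 1 / ((j : ℝ) + 1)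
  have hε : ∀ j, 0 < ε j := fun j => Nat.one_div_pos_of_nat
  have hlim : Tendsto ε atTop (nhds 0) := tendsto_one_div_add_atTop_nhds_zero_nat
  let p : ℕ → ℝ → ℝ := fun j t => (√(t + ε j))⁻¹
  have hp : ∀ j, ContinuousOn (p j) (spectrum ℝ X) := fun j =>
    ContinuousOn.inv₀ (by fun_prop) fun t ht =>
      (Real.sqrt_pos.2 (add_pos_of_nonneg_of_pos (hspec t ht) (hε j))).ne'
  let k : ℕ → ℝ → ℝ := fun j t => ε j * (p j t * p j t)
  have hk : ∀ j, ContinuousOn (k j) (spectrum ℝ X) := fun j =>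
    continuousOn_const.mul ((hp j).mul (hp j))
  have hkval : ∀ j, ∀ t ∈ spectrum ℝ X, k j t = ε j / (t + ε j) := fun j t ht => by
    simp only [k, p]
    rw [← mul_inv, Real.mul_self_sqrt (add_pos_of_nonneg_of_pos (hspec t ht) (hε j)).le]
    rfl
  let P : ℕ → E →L[ℂ] E := fun j => cfc (p j) X
  let K : ℕ → E →L[ℂ] E := fun j => cfc (k j) X
  have hKbound : ∀ j, ‖K j‖ ≤ 1 := fun j => by
    refine norm_cfc_le zero_le_one fun t ht => ?_
    have h1 := hspec t ht
    have h2 := hε j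
    rw [hkval j t ht, Real.norm_of_nonneg (by positivity), div_le_one (by positivity)]
    linarith
  have hXK : ∀ j, ‖X * K j‖ ≤ ε j := fun j => by
    have h0 : X * K j = cfc (fun t => t * k j t) X := by
      rw [cfc_mul (fun t => t) (k j) X continuousOn_id (hk j), cfc_id' ℝ X]
    rw [h0]
    refine norm_cfc_le (hε j).le fun t ht => ?_
    have h1 := hspec t ht
    have h2 := hε j
    rw [hkval j t ht, Real.norm_of_nonneg (by positivity), mul_div_assoc', div_le_iff₀
      (by positivity)]
    nlinarith
  have hzero : Tendsto (fun j => A * X * K j) atTop (nhds 0) := by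
    rw [tendsto_zero_iff_norm_tendsto_zero]
    refine squeeze_zero (fun j => norm_nonneg _) (fun j => ?_) (by simpa using hlim.const_mul ‖A‖)
    rw [mul_assoc]
    exact (norm_mul_le _ _).trans (mul_le_mul_of_nonneg_left (hXK j) (norm_nonneg _))
  have htend := h.tendsto_opTrace_mul K hKbound hzero
  have hmain : ∀ j, 0 ≤ opTrace (A * X) - opTrace (A * X * K j) := fun j => by
    have hPs : star (X * P j) = X * P j := by
      have h0 : X * P j = cfc (fun t => t * p j t) X := by
        rw [cfc_mul (fun t => t) (p j) X continuousOn_id (hp j), cfc_id' ℝ X]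
      rw [h0]
      exact cfc_predicate (R := ℝ) _ X
    have h1 : A * X * P j * (X * P j) = A * X - A * X * K j := by
      have h2 : X * (P j * (X * P j)) = X - X * K j := by
        have e1 : X * (P j * (X * P j)) = cfc (fun t => t * (p j t * (t * p j t))) X := by
          rw [cfc_mul (fun t => t) _ X continuousOn_id (by fun_prop), cfc_mul (p j) _ X (hp j)
            (by fun_prop), cfc_mul (fun t => t) (p j) X continuousOn_id (hp j), cfc_id' ℝ X]
        have e2 : X - X * K j = cfc (fun t => t - t * k j t) X := by
          rw [cfc_sub (fun t => t) _ X continuousOn_id (by fun_prop),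
            cfc_mul (fun t => t) (k j) X continuousOn_id (hk j), cfc_id' ℝ X]
        rw [e1, e2]
        refine cfc_congr fun t ht => ?_
        have h1 := hspec t ht
        have h2 := hε j
        have h3 : p j t * p j t = (t + ε j)⁻¹ := by
          simp only [p]
          rw [← mul_inv, Real.mul_self_sqrt (by positivity)]
        have h4 : t * (p j t * (t * p j t)) = t * t * (p j t * p j t) := by ring
        simp only [k, h4, h3]
        field_simp
        ring
      rw [mul_assoc, mul_assoc, h2, mul_sub, mul_assoc]
    rw [← h.opTrace_sub_mul, ← h1, h.opTrace_mul_mul_comm, mul_assoc, mul_assoc]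
    refine opTrace_nonneg ?_
    have h3 := hA.conj_adjoint (X * P j)
    rwa [← ContinuousLinearMap.star_eq_adjoint, hPs] at h3
  have := ge_of_tendsto' (tendsto_const_nhds.sub htend) hmain
  simpa using this

end TracePositivity

/-! ### Tensor powers of operators -/

namespace HilbertPow

open scoped ComplexOrder

variable {H : Type*} [NormedAddCommGroup H] [InnerProductSpace ℂ H]

theorem clm_ext {n : ℕ} {F : Type*} [NormedAddCommGroup F] [NormedSpace ℂ F]
    {f g : HilbertPow H n →L[ℂ] F} (h : ∀ x, f (tprod x) = g (tprod x)) : f = g := by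
  ext u
  induction u using UniformSpace.Completion.induction_on with
  | hp => exact isClosed_eq f.continuous g.continuous
  | ih u =>
    exact LinearMap.congr_fun (AlgPow.linearMap_ext
      (f := (f : HilbertPow H n →ₗ[ℂ] F) ∘ₗ (UniformSpace.Completion.toComplL (𝕜 := ℂ)
        (E := AlgPow H n) : AlgPow H n →ₗ[ℂ] HilbertPow H n))
      (g := (g : HilbertPow H n →ₗ[ℂ] F) ∘ₗ (UniformSpace.Completion.toComplL (𝕜 := ℂ)
        (E := AlgPow H n) : AlgPow H n →ₗ[ℂ] HilbertPow H n)) h) u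

theorem opPow_mul (A B : H →L[ℂ] H) (n : ℕ) : opPow (A * B) n = opPow A n * opPow B n :=
  clm_ext fun x => by
    rw [mul_apply_eq_comp, opPow_tprod, opPow_tprod, opPow_tprod]
    rfl

theorem opPow_adjoint [CompleteSpace H] (A : H →L[ℂ] H) (n : ℕ) :
    (opPow A n).adjoint = opPow A.adjoint n := by
  refine clm_ext fun x => ?_
  rw [← sub_eq_zero, ← inner_self_eq_zero (𝕜 := ℂ)]
  have h : innerSL ℂ ((opPow A n).adjoint (tprod x)) =
      innerSL ℂ (opPow A.adjoint n (tprod x)) := clm_ext fun y => by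
    rw [innerSL_apply_apply, innerSL_apply_apply, ContinuousLinearMap.adjoint_inner_left,
      opPow_tprod, opPow_tprod, inner_tprod, inner_tprod]
    simp only [ContinuousLinearMap.adjoint_inner_left]
  have h1 := fun z => congrArg (fun l : HilbertPow H n →L[ℂ] ℂ => l z) h
  simp only [innerSL_apply_apply] at h1
  rw [inner_sub_left, h1, sub_self]

theorem opPow_isPositive [CompleteSpace H] {A : H →L[ℂ] H} (hA : A.IsPositive) (n : ℕ) :
    (opPow A n).IsPositive := by
  have hA0 : 0 ≤ A := (ContinuousLinearMap.nonneg_iff_isPositive A).2 hA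
  have hs : (CFC.sqrt A).adjoint = CFC.sqrt A := (CFC.sqrt_nonneg A).isSelfAdjoint
  rw [← CFC.sqrt_mul_sqrt_self A hA0, opPow_mul]
  nth_rewrite 1 [← hs]
  rw [← opPow_adjoint]
  exact ContinuousLinearMap.isPositive_adjoint_comp_self _

/-- Density in one variable at a time: with the other factor fixed, the admissible vectors form a
closed subspace. This yields totality of the product basis. -/
theorem concat_mem {n m : ℕ} (M : Submodule ℂ (HilbertPow H (n + m)))
    (hM : IsClosed (M : Set (HilbertPow H (n + m))))
    {S : Set (HilbertPow H n)} {T : Set (HilbertPow H m)}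
    (hS : ⊤ ≤ (Submodule.span ℂ S).topologicalClosure)
    (hT : ⊤ ≤ (Submodule.span ℂ T).topologicalClosure)
    (h : ∀ u ∈ S, ∀ v ∈ T, concat n m (u ⊗ₜ[ℂ] v) ∈ M) (w : HilbertPow H n ⊗[ℂ] HilbertPow H m) :
    concat n m w ∈ M := by
  have hcl : ∀ {k : ℕ} {S : Set (HilbertPow H k)}
      (_ : ⊤ ≤ (Submodule.span ℂ S).topologicalClosure)
      (f : HilbertPow H k →L[ℂ] HilbertPow H (n + m)), (∀ u ∈ S, f u ∈ M) → ∀ u, f u ∈ M := by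
    intro k S hS f hf u
    have h1 : Submodule.span ℂ S ≤ M.comap (f : HilbertPow H k →ₗ[ℂ] HilbertPow H (n + m)) :=
      Submodule.span_le.2 hf
    exact Submodule.topologicalClosure_minimal _ h1 (hM.preimage f.continuous)
      (hS Submodule.mem_top)
  have hl : ∀ v, Continuous fun u : HilbertPow H n => u ⊗ₜ[ℂ] (v : HilbertPow H m) := fun v =>
    TensorProduct.continuous_tmul.comp (by fun_prop : Continuous fun u => (u, v))
  have hr : ∀ u, Continuous fun v : HilbertPow H m => (u : HilbertPow H n) ⊗ₜ[ℂ] v := fun u =>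
    TensorProduct.continuous_tmul.comp (by fun_prop : Continuous fun v => (u, v))
  induction w using TensorProduct.induction_on with
  | zero => simp
  | add s t hs ht => rw [map_add]; exact M.add_mem hs ht
  | tmul u v =>
    refine hcl hS (concat n m ∘L ⟨(TensorProduct.mk ℂ _ _).flip v, hl v⟩) (fun u hu => ?_) u
    exact hcl hT (concat n m ∘L ⟨TensorProduct.mk ℂ _ _ u, hr u⟩) (fun v hv => h u hu v hv) v

theorem opPow_concat (A : H →L[ℂ] H) {n m : ℕ} (w : HilbertPow H n ⊗[ℂ] HilbertPow H m) :
    opPow A (n + m) (concat n m w) =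
      concat n m (TensorProduct.mapL (opPow A n) (opPow A m) w) := by
  refine (denseRange_incl n m).induction_on w (isClosed_eq (by fun_prop) (by fun_prop)) fun s => ?_
  induction s using TensorProduct.induction_on with
  | zero => simp
  | add s t hs ht => simp only [map_add, hs, ht]
  | tmul a b =>
    change opPow A (n + m) (concat n m ((a : HilbertPow H n) ⊗ₜ[ℂ] (b : HilbertPow H m))) =
      concat n m (opPow A n (a : HilbertPow H n) ⊗ₜ[ℂ] opPow A m (b : HilbertPow H m))
    induction a using AlgPow.induction with
    | h2 u v hu hv =>
      simp only [UniformSpace.Completion.coe_add, map_add, TensorProduct.add_tmul, hu, hv]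
    | h1 c x =>
      induction b using AlgPow.induction with
      | h2 u v hu hv =>
        simp only [UniformSpace.Completion.coe_add, map_add, TensorProduct.tmul_add, hu, hv]
      | h1 d y =>
        have h1 : opPow A (n + m) (concat n m (tprod x ⊗ₜ[ℂ] tprod y)) =
            concat n m (opPow A n (tprod x) ⊗ₜ[ℂ] opPow A m (tprod y)) := by
          rw [concat_tprod, opPow_tprod, opPow_tprod, opPow_tprod, concat_tprod]
          congr 1
          funext i
          refine Fin.addCases (fun i => ?_) (fun i => ?_) i
          · simp only [Fin.append_left]
          · simp only [Fin.append_right]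
        simp only [UniformSpace.Completion.coe_smul, map_smul, ← TensorProduct.smul_tmul',
          TensorProduct.tmul_smul]
        exact congrArg (fun z => d • c • z) h1

theorem inner_concat {n m : ℕ} (s t : HilbertPow H n ⊗[ℂ] HilbertPow H m) :
    ⟪concat n m s, concat n m t⟫_ℂ = ⟪s, t⟫_ℂ := by
  refine (denseRange_incl n m).induction_on₂ (p := fun s t => ⟪concat n m s, concat n m t⟫_ℂ =
    ⟪s, t⟫_ℂ) (isClosed_eq
      (((concat n m).continuous.comp continuous_fst).inner
        ((concat n m).continuous.comp continuous_snd))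
      (continuous_inner (𝕜 := ℂ) (E := HilbertPow H n ⊗[ℂ] HilbertPow H m))) (fun s t => ?_) s t
  have h := congrArg₂ (fun a b => ⟪a, b⟫_ℂ) (concat_incl n m s) (concat_incl n m t)
  refine h.trans ?_
  rw [UniformSpace.Completion.inner_coe, LinearIsometryEquiv.inner_map_map]
  exact ((incl n m).inner_map_map s t).symm

theorem orthonormal_concat {n m : ℕ} {ι κ : Type*} {b : ι → HilbertPow H n}
    {c : κ → HilbertPow H m} (hb : Orthonormal ℂ b) (hc : Orthonormal ℂ c) :
    Orthonormal ℂ fun p : ι × κ => concat n m (b p.1 ⊗ₜ[ℂ] c p.2) := by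
  classical
  rw [orthonormal_iff_ite] at hb hc ⊢
  intro p q
  rw [inner_concat, TensorProduct.inner_tmul, hb, hc]
  simp only [Prod.ext_iff]
  split_ifs <;> simp_all

/-- The product basis of `H^{⊗(n+m)}`. -/
noncomputable def concatBasis {n m : ℕ} {ι κ : Type*} (b : HilbertBasis ι ℂ (HilbertPow H n))
    (c : HilbertBasis κ ℂ (HilbertPow H m)) : HilbertBasis (ι × κ) ℂ (HilbertPow H (n + m)) :=
  HilbertBasis.mk (orthonormal_concat b.orthonormal c.orthonormal) <| by
    set M := (Submodule.span ℂ (Set.range fun p : ι × κ =>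
      concat n m (b p.1 ⊗ₜ[ℂ] c p.2))).topologicalClosure with hMdef
    have hM : IsClosed (M : Set (HilbertPow H (n + m))) := Submodule.isClosed_topologicalClosure _
    have h := concat_mem M hM b.dense_span.ge c.dense_span.ge (by
      rintro _ ⟨i, rfl⟩ _ ⟨j, rfl⟩
      exact Submodule.le_topologicalClosure _ (Submodule.subset_span ⟨(i, j), rfl⟩))
    rintro u -
    induction u using UniformSpace.Completion.induction_on with
    | hp => exact hM
    | ih u =>
      obtain ⟨s, rfl⟩ := (AlgPow.mulIsometry n m).surjective u
      rw [← concat_incl]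
      exact h _

theorem concatBasis_apply {n m : ℕ} {ι κ : Type*} (b : HilbertBasis ι ℂ (HilbertPow H n))
    (c : HilbertBasis κ ℂ (HilbertPow H m)) (p : ι × κ) :
    concatBasis b c p = concat n m (b p.1 ⊗ₜ[ℂ] c p.2) := by
  rw [concatBasis, HilbertBasis.coe_mk]

variable {n m : ℕ} {x₁ : HilbertPow H n →L[ℂ] HilbertPow H n}
  {x₂ : HilbertPow H m →L[ℂ] HilbertPow H m}

/-- In the product basis every diagonal entry factors, and absolute summability turns the double
series into a product. Basis independence allows the use of this basis. -/
theorem opTrace_opPow_mul_opTensor (A : H →L[ℂ] H) (h₁ : IsTraceClass (opPow A n * x₁))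
    (h₂ : IsTraceClass (opPow A m * x₂))
    (h : IsTraceClass (opPow A (n + m) * opTensor x₁ x₂)) :
    opTrace (opPow A (n + m) * opTensor x₁ x₂) =
      opTrace (opPow A n * x₁) * opTrace (opPow A m * x₂) := by
  have s₁ := (h₁.summable_inner (someHilbertBasis _)).norm
  have s₂ := (h₂.summable_inner (someHilbertBasis _)).norm
  rw [h.opTrace_eq_tsum (concatBasis (someHilbertBasis _) (someHilbertBasis _)), opTrace, opTrace,
    tsum_mul_tsum_of_summable_norm s₁ s₂]
  refine tsum_congr fun p => ?_
  rw [concatBasis_apply, mul_apply_eq_comp, opTensor_concat, opPow_concat, inner_concat]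
  exact TensorProduct.inner_tmul (𝕜 := ℂ) (E := HilbertPow H n) (F := HilbertPow H m) _ _ _ _

variable [CompleteSpace H]

theorem re_opTrace_nonneg_and_im_eq_zero {A : H →L[ℂ] H} (hA : A.IsPositive) (hx : x₁.IsPositive)
    (h : IsTraceClass (opPow A n * x₁)) :
    0 ≤ (opTrace (opPow A n * x₁)).re ∧ (opTrace (opPow A n * x₁)).im = 0 := by
  have := Complex.nonneg_iff.1
    (opTrace_mul_nonneg (opPow_isPositive hA n) hx h)
  exact ⟨this.1, this.2.symm⟩

theorem re_opTrace_opTensor {A : H →L[ℂ] H} (hA : A.IsPositive) (hx₁ : x₁.IsPositive)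
    (h₁ : IsTraceClass (opPow A n * x₁))
    (h₂ : IsTraceClass (opPow A m * x₂))
    (h : IsTraceClass (opPow A (n + m) * opTensor x₁ x₂)) :
    (opTrace (opPow A (n + m) * opTensor x₁ x₂)).re =
      (opTrace (opPow A n * x₁)).re * (opTrace (opPow A m * x₂)).re := by
  rw [opTrace_opPow_mul_opTensor A h₁ h₂ h, Complex.mul_re, (re_opTrace_nonneg_and_im_eq_zero hA hx₁ h₁).2]
  simp

end HilbertPow

/-! ### The integral of the logarithm -/

section LogIntegral

/-- Since `exp (-k) ≤ 1`, truncating the argument from below leaves the positive part of the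
logarithm unchanged. -/
theorem toENNReal_log_ofReal {t : ℝ} (ht : 0 ≤ t) (k : ℕ) :
    (ENNReal.log (ENNReal.ofReal t)).toENNReal =
      ENNReal.ofReal (Real.log (max t (Real.exp (-k)))) := by
  have hk : (0 : ℝ) ≤ k := k.cast_nonneg
  rcases ht.eq_or_lt with rfl | ht
  · rw [ENNReal.ofReal_zero, ENNReal.log_zero, EReal.toENNReal_bot,
      max_eq_right (Real.exp_pos _).le, Real.log_exp, ENNReal.ofReal_of_nonpos (by linarith)]
  · rw [ENNReal.log_ofReal_of_pos ht, EReal.real_coe_toENNReal]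
    rcases le_total (Real.exp (-k)) t with h | h
    · rw [max_eq_left h]
    · have := Real.log_le_log ht h
      rw [Real.log_exp] at this
      rw [max_eq_right h, Real.log_exp, ENNReal.ofReal_of_nonpos (by linarith),
        ENNReal.ofReal_of_nonpos (by linarith)]

theorem ofReal_neg_log_max {t : ℝ} (ht : 0 ≤ t) (k : ℕ) :
    ENNReal.ofReal (-Real.log (max t (Real.exp (-k)))) =
      min (-ENNReal.log (ENNReal.ofReal t)).toENNReal k := by
  rcases ht.eq_or_lt with rfl | ht
  · rw [ENNReal.ofReal_zero, ENNReal.log_zero, EReal.neg_bot, EReal.toENNReal_top,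
      max_eq_right (Real.exp_pos _).le, Real.log_exp, neg_neg, min_eq_right le_top,
      ENNReal.ofReal_natCast]
  · rw [ENNReal.log_ofReal_of_pos ht, ← EReal.coe_neg, EReal.real_coe_toENNReal,
      ← ENNReal.ofReal_natCast, ← ENNReal.ofReal_min]
    congr 1
    have h : Real.log (max t (Real.exp (-k))) = max (Real.log t) (-k) := by
      rcases le_total (Real.exp (-k)) t with h | h
      · rw [max_eq_left h, max_eq_left]
        have := Real.log_le_log (Real.exp_pos _) h
        rwa [Real.log_exp] at this
      · rw [max_eq_right h, max_eq_right, Real.log_exp]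
        have := Real.log_le_log ht h
        rwa [Real.log_exp] at this
    rw [h, ← min_neg_neg, neg_neg]

theorem iSup_min_natCast (x : ℝ≥0∞) : ⨆ k : ℕ, min x k = x := by
  refine le_antisymm (iSup_le fun k => min_le_left _ _) ?_
  induction x with
  | top => simp [ENNReal.iSup_natCast]
  | coe x =>
    obtain ⟨k, hk⟩ := exists_nat_ge x
    exact le_iSup_of_le k (le_min le_rfl (by exact_mod_cast hk))

theorem continuous_log_max_exp {Y : Type*} [TopologicalSpace Y] {f : Y → ℝ} (hf : Continuous f)
    (k : ℕ) :
    Continuous fun y => Real.log (max (f y) (Real.exp (-k))) :=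
  (hf.max continuous_const).log fun _ => (lt_max_of_lt_right (Real.exp_pos _)).ne'

variable {Y : Type*} [TopologicalSpace Y] [CompactSpace Y] [MeasurableSpace Y] [BorelSpace Y]
  {ν : Measure Y} [IsProbabilityMeasure ν] {f : Y → ℝ}

theorem Continuous.integrable_of_compactSpace (hf : Continuous f) : Integrable f ν :=
  hf.integrable_of_hasCompactSupport (HasCompactSupport.of_compactSpace _)

theorem integral_log_max_exp (hf : Continuous f) (hf0 : ∀ y, 0 ≤ f y) (k : ℕ) :
    (∫⁻ y, (ENNReal.log (ENNReal.ofReal (f y))).toENNReal ∂ν) ≠ ⊤ ∧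
    (∫⁻ y, min (-ENNReal.log (ENNReal.ofReal (f y))).toENNReal k ∂ν) ≠ ⊤ ∧
    ∫ y, Real.log (max (f y) (Real.exp (-k))) ∂ν =
      (∫⁻ y, (ENNReal.log (ENNReal.ofReal (f y))).toENNReal ∂ν).toReal -
      (∫⁻ y, min (-ENNReal.log (ENNReal.ofReal (f y))).toENNReal k ∂ν).toReal := by
  have hi : Integrable (fun y => Real.log (max (f y) (Real.exp (-k)))) ν :=
    (continuous_log_max_exp hf k).integrable_of_compactSpace
  simp only [toENNReal_log_ofReal (hf0 _) k, ← ofReal_neg_log_max (hf0 _) k]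
  exact ⟨hi.lintegral_lt_top.ne, hi.neg.lintegral_lt_top.ne,
    integral_eq_lintegral_pos_part_sub_lintegral_neg_part hi⟩

theorem erealIntegral_log_le (hf : Continuous f) (hf0 : ∀ y, 0 ≤ f y) (k : ℕ) :
    erealIntegral ν (fun y => ENNReal.log (ENNReal.ofReal (f y))) ≤
      ((∫ y, Real.log (max (f y) (Real.exp (-k))) ∂ν : ℝ) : EReal) := by
  obtain ⟨hP, hN, h⟩ := integral_log_max_exp (ν := ν) hf hf0 k
  rw [h, EReal.coe_sub, EReal.coe_ennreal_toReal hP, EReal.coe_ennreal_toReal hN, erealIntegral]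
  exact EReal.sub_le_sub le_rfl
    (EReal.coe_ennreal_le_coe_ennreal_iff.2 (lintegral_mono fun y => min_le_left _ _))

/-- Monotone convergence: the truncated negative parts increase to `log⁻ f`, so a lower bound
uniform in `k` gives `∫ log⁻ f ≤ ∫ log⁺ f - l`. The positive part has finite integral by
compactness. -/
theorem le_erealIntegral_log (hf : Continuous f) (hf0 : ∀ y, 0 ≤ f y) {l : ℝ}
    (hl : ∀ k : ℕ, l ≤ ∫ y, Real.log (max (f y) (Real.exp (-k))) ∂ν) :
    (l : EReal) ≤ erealIntegral ν (fun y => ENNReal.log (ENNReal.ofReal (f y))) := by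
  have hP := (integral_log_max_exp (ν := ν) hf hf0 0).1
  rw [erealIntegral]
  set P := ∫⁻ y, (ENNReal.log (ENNReal.ofReal (f y))).toENNReal ∂ν with hPdef
  have hN : ∫⁻ y, (-ENNReal.log (ENNReal.ofReal (f y))).toENNReal ∂ν ≤
      ENNReal.ofReal (P.toReal - l) := by
    have h1 : ∀ y, (-ENNReal.log (ENNReal.ofReal (f y))).toENNReal =
        ⨆ k : ℕ, min (-ENNReal.log (ENNReal.ofReal (f y))).toENNReal k :=
      fun y => (iSup_min_natCast _).symm
    rw [lintegral_congr h1, lintegral_iSup]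
    · refine iSup_le fun k => ?_
      obtain ⟨-, hNk, h⟩ := integral_log_max_exp (ν := ν) hf hf0 k
      refine (ENNReal.le_ofReal_iff_toReal_le hNk ?_).2 ?_
      · have h2 := hl k
        have h3 := ENNReal.toReal_nonneg
          (a := ∫⁻ y, min (-ENNReal.log (ENNReal.ofReal (f y))).toENNReal k ∂ν)
        rw [h] at h2
        linarith
      · have h2 := hl k
        rw [h] at h2
        linarith
    · intro k
      simp only [← ofReal_neg_log_max (hf0 _) k]
      exact (continuous_log_max_exp hf k).measurable.neg.ennreal_ofReal
    · exact fun i j hij y => min_le_min le_rfl (by exact_mod_cast hij)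
  -- This keeps `ENNReal.ofReal` from cutting the difference off at zero.
  have h0 : 0 ≤ P.toReal - l := by
    obtain ⟨-, -, h⟩ := integral_log_max_exp (ν := ν) hf hf0 0
    have h2 := hl 0
    rw [h] at h2
    have h3 := ENNReal.toReal_nonneg
      (a := ∫⁻ y, min (-ENNReal.log (ENNReal.ofReal (f y))).toENNReal (0 : ℕ) ∂ν)
    linarith
  calc (l : EReal) = (P : EReal) - (ENNReal.ofReal (P.toReal - l) : EReal) := by
        rw [EReal.coe_ennreal_ofReal, max_eq_left h0, ← EReal.coe_ennreal_toReal hP,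
          ← EReal.coe_sub, sub_sub_cancel]
    _ ≤ _ := EReal.sub_le_sub le_rfl (EReal.coe_ennreal_le_coe_ennreal_iff.2 hN)

/-- Jensen's inequality. -/
theorem exp_erealIntegral_log_le (hf : Continuous f) (hf0 : ∀ y, 0 ≤ f y) :
    EReal.exp (erealIntegral ν (fun y => ENNReal.log (ENNReal.ofReal (f y)))) ≤
      ∫⁻ y, ENNReal.ofReal (f y) ∂ν := by
  have hfi : Integrable f ν := hf.integrable_of_compactSpace
  -- Jensen is applied to the truncated logarithm, whose exponential is `max f (exp (-k)) ≤ f + exp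
  -- (-k)`; then `k → ∞`.
  have h1 : ∀ k : ℕ, EReal.exp (erealIntegral ν (fun y => ENNReal.log (ENNReal.ofReal (f y)))) ≤
      ENNReal.ofReal (∫ y, f y ∂ν + Real.exp (-k)) := fun k => by
    refine (EReal.exp_monotone (erealIntegral_log_le hf hf0 k)).trans ?_
    rw [EReal.exp_coe]
    refine ENNReal.ofReal_le_ofReal ?_
    have hc := continuous_log_max_exp hf k
    have h2 := convexOn_exp.map_integral_le (μ := ν) Real.continuous_exp.continuousOn isClosed_univ
      (Eventually.of_forall fun _ => Set.mem_univ _) hc.integrable_of_compactSpace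
      (Real.continuous_exp.comp hc).integrable_of_compactSpace
    refine h2.trans ?_
    have h3 : ∫ y, (f y + Real.exp (-k)) ∂ν = ∫ y, f y ∂ν + Real.exp (-k) := by
      rw [integral_add hfi (integrable_const _)]
      simp
    rw [← h3]
    refine integral_mono (Real.continuous_exp.comp hc).integrable_of_compactSpace
      (hfi.add (integrable_const _)) fun y => ?_
    beta_reduce
    rw [Real.exp_log (lt_max_of_lt_right (Real.exp_pos _))]
    exact max_le (le_add_of_nonneg_right (Real.exp_pos _).le) (le_add_of_nonneg_left (hf0 y))
  have h4 : Tendsto (fun k : ℕ => ENNReal.ofReal (∫ y, f y ∂ν + Real.exp (-k))) atTop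
      (nhds (ENNReal.ofReal (∫ y, f y ∂ν + 0))) :=
    ENNReal.tendsto_ofReal (tendsto_const_nhds.add
      (Real.tendsto_exp_neg_atTop_nhds_zero.comp tendsto_natCast_atTop_atTop))
  rw [← ofReal_integral_eq_lintegral_ofReal hfi (Eventually.of_forall hf0), ← add_zero (∫ y, f y ∂ν)]
  exact ge_of_tendsto' h4 h1

end LogIntegral

/-! ### Existence of probability measures -/

section ProbabilityMeasures

variable {Y : Type*} [TopologicalSpace Y] [CompactSpace Y]

/-- Approximates `r` by `(⌊r (k+1)⌋ + 1) / (k+1)`. The added one keeps the numerator positive, so `r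
= 0` is included. -/
theorem smul_mem_closure_of_floor {V : Type*} [NormedAddCommGroup V] [NormedSpace ℝ V]
    {S : Set V} (hnat : ∀ g ∈ S, ∀ k : ℕ, (k + 1 : ℝ) • g ∈ S)
    (hdiv : ∀ g ∈ S, ∀ k : ℕ, (k + 1 : ℝ)⁻¹ • g ∈ S) {g : V} (hg : g ∈ S) {r : ℝ} (hr : 0 ≤ r) :
    r • g ∈ closure S := by
  have h1 : Tendsto (fun k : ℕ => (((⌊r * ((k : ℝ) + 1)⌋₊ : ℝ) + 1) / ((k : ℝ) + 1)) • g) atTop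
      (nhds (r • g)) := by
    refine Tendsto.smul_const ?_ g
    have h2 := ((tendsto_nat_floor_mul_div_atTop hr).comp
      (tendsto_atTop_add_const_right _ (1 : ℝ) tendsto_natCast_atTop_atTop)).add
      (tendsto_one_div_add_atTop_nhds_zero_nat (𝕜 := ℝ))
    rw [add_zero] at h2
    refine h2.congr fun k => ?_
    simp only [Function.comp_apply]
    ring
  refine mem_closure_of_tendsto h1 (Eventually.of_forall fun k => ?_)
  rw [div_eq_mul_inv, mul_smul]
  exact hnat _ (hdiv _ hg _) _

theorem convex_closure_of_smul {V : Type*} [NormedAddCommGroup V] [NormedSpace ℝ V]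
    {S : Set V} (hadd : ∀ g ∈ S, ∀ h ∈ S, g + h ∈ S)
    (hsmul : ∀ g ∈ S, ∀ r : ℝ, 0 ≤ r → r • g ∈ closure S) : Convex ℝ (closure S) := by
  have hadd' : ∀ g ∈ closure S, ∀ h ∈ closure S, g + h ∈ closure S := fun g hg h hh =>
    map_mem_closure₂ continuous_add hg hh hadd
  have hsmul' : ∀ g ∈ closure S, ∀ r : ℝ, 0 ≤ r → r • g ∈ closure S := fun g hg r hr => by
    have := map_mem_closure (continuous_const_smul r) hg (fun x hx => hsmul x hx r hr)
    rwa [closure_closure] at this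
  exact fun g hg h hh a b ha hb _ => hadd' _ (hsmul' g hg a ha) _ (hsmul' h hh b hb)

variable [T2Space Y] [MeasurableSpace Y] [BorelSpace Y]

/-- A positive functional on `C(Y)`, nonzero on constants, is a multiple of the integral with
respect to a probability measure. -/
theorem exists_probabilityMeasure_of_positive (L : C(Y, ℝ) →ₗ[ℝ] ℝ) (hL : ∀ g, 0 ≤ g → 0 ≤ L g)
    (h1 : 0 < L 1) : ∃ ν : Measure Y, IsProbabilityMeasure ν ∧ ∀ g, L g = L 1 * ∫ y, g y ∂ν := by
  let Λ₀ : CompactlySupportedContinuousMap Y ℝ →ₗ[ℝ] ℝ :=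
    { toFun := fun f => (L 1)⁻¹ * L f.toContinuousMap
      map_add' := fun f g => by
        rw [← mul_add, ← map_add]
        rfl
      map_smul' := fun r f => by
        rw [RingHom.id_apply, smul_eq_mul, mul_left_comm, ← smul_eq_mul r, ← map_smul]
        rfl }
  let Λ : CompactlySupportedContinuousMap Y ℝ →ₚ[ℝ] ℝ :=
    PositiveLinearMap.mk₀ Λ₀ fun f hf => mul_nonneg (inv_pos.2 h1).le (hL _ hf)
  have hint : ∀ g : C(Y, ℝ), ∫ y, g y ∂(RealRMK.rieszMeasure Λ) = (L 1)⁻¹ * L g := fun g =>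
    RealRMK.integral_rieszMeasure Λ
      (CompactlySupportedContinuousMap.continuousMapEquiv g)
  refine ⟨RealRMK.rieszMeasure Λ, ⟨?_⟩, fun g => ?_⟩
  · have h2 := hint 1
    rw [inv_mul_cancel₀ h1.ne'] at h2
    simpa [Measure.real, ENNReal.toReal_eq_one_iff] using h2
  · rw [hint, mul_inv_cancel_left₀ h1.ne']

/-- The strictly negative functions form an open convex set disjoint from `S`, hence from its
closure, which is a convex cone. A separating functional is positive, and Riesz representation
applies. -/
theorem exists_probabilityMeasure_integral_nonneg {S : Set C(Y, ℝ)} (hne : S.Nonempty)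
    (hadd : ∀ g ∈ S, ∀ h ∈ S, g + h ∈ S) (hnat : ∀ g ∈ S, ∀ k : ℕ, (k + 1 : ℝ) • g ∈ S)
    (hdiv : ∀ g ∈ S, ∀ k : ℕ, (k + 1 : ℝ)⁻¹ • g ∈ S) (hS : ∀ g ∈ S, ∃ y, 0 ≤ g y) :
    ∃ ν : Measure Y, IsProbabilityMeasure ν ∧ ∀ g ∈ S, 0 ≤ ∫ y, g y ∂ν := by
  have hsmul : ∀ g ∈ S, ∀ r : ℝ, 0 ≤ r → r • g ∈ closure S := fun g hg r hr =>
    smul_mem_closure_of_floor hnat hdiv hg hr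
  let N : Set C(Y, ℝ) := {g | Set.MapsTo g Set.univ (Set.Iio 0)}
  have hN : IsOpen N := ContinuousMap.isOpen_setOfPred_mapsTo isCompact_univ isOpen_Iio
  have hNconv : Convex ℝ N := fun g hg h hh a b ha hb hab y hy => by
    have h1 : g y < 0 := hg hy
    have h2 : h y < 0 := hh hy
    exact convex_Iio (0 : ℝ) h1 h2 ha hb hab
  have hdisj : Disjoint N (closure S) := by
    refine Disjoint.closure_right ?_ hN
    refine Set.disjoint_left.2 fun g hg hgS => ?_
    obtain ⟨y, hy⟩ := hS g hgS
    exact absurd (hg (Set.mem_univ y)) hy.not_gt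
  obtain ⟨L, u, hLN, hLS⟩ :=
    geometric_hahn_banach_open hNconv hN (convex_closure_of_smul hadd hsmul) hdisj
  obtain ⟨g₀, hg₀⟩ := hne
  have hu : u ≤ 0 := by
    have := hLS _ (hsmul g₀ hg₀ 0 le_rfl)
    simpa using this
  have hL1 : 0 < L 1 := by
    have h1 : (-1 : C(Y, ℝ)) ∈ N := fun y _ => by simp
    have := hLN _ h1
    rw [map_neg] at this
    linarith
  -- A nonnegative `g` is shifted up by a small constant so that its negative is strictly negative.
  have hLpos : ∀ g, 0 ≤ g → 0 ≤ L g := fun g hg => by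
    refine le_of_forall_pos_le_add fun ε hε => ?_
    have h1 : (-(g + (ε / L 1) • (1 : C(Y, ℝ)))) ∈ N := fun y _ => by
      have h2 : 0 ≤ g y := hg y
      have h3 : 0 < ε / L 1 := by positivity
      simp only [ContinuousMap.neg_apply, ContinuousMap.add_apply, ContinuousMap.smul_apply,
        ContinuousMap.one_apply, smul_eq_mul, mul_one, Set.mem_Iio]
      linarith
    have h2 := hLN _ h1
    rw [map_neg, map_add, map_smul, smul_eq_mul, div_mul_cancel₀ _ hL1.ne'] at h2
    linarith
  -- If `L g < 0`, large multiples of `g` would violate the lower bound `u`.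
  have hLS0 : ∀ g ∈ S, 0 ≤ L g := fun g hg => by
    by_contra! hneg
    obtain ⟨k, hk⟩ := exists_nat_gt (u / L g)
    have h1 := hLS _ (hsmul g hg k k.cast_nonneg)
    rw [div_lt_iff_of_neg hneg] at hk
    rw [map_smul, smul_eq_mul] at h1
    linarith
  obtain ⟨ν, hν, hint⟩ := exists_probabilityMeasure_of_positive (L : C(Y, ℝ) →ₗ[ℝ] ℝ) hLpos hL1
  refine ⟨ν, hν, fun g hg => ?_⟩
  have h1 := hLS0 g hg
  have h2 : L g = L 1 * ∫ y, g y ∂ν := hint g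
  rw [h2] at h1
  exact nonneg_of_mul_nonneg_right h1 hL1

end ProbabilityMeasures

/-! ### Multiplicative families of functions -/

section MultiplicativeFamilies

variable {Y : Type*} {ι : Type*} {f : ι → Y → ℝ} {c : ι → ℝ} {d : ι → ℕ}

/-- Exponents start at one because the family need not contain a unit. -/
theorem exists_pow_of_mul
    (hmul : ∀ a b, ∃ e, (∀ y, f e y = f a y * f b y) ∧ c e = c a * c b ∧ d e = d a + d b)
    (a : ι) (k : ℕ) :
    ∃ e, (∀ y, f e y = f a y ^ (k + 1)) ∧ c e = c a ^ (k + 1) ∧ d e = d a * (k + 1) := by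
  induction k with
  | zero => exact ⟨a, by simp⟩
  | succ k ih =>
    obtain ⟨e, hf, hc, hd⟩ := ih
    obtain ⟨e', hf', hc', hd'⟩ := hmul e a
    refine ⟨e', fun y => ?_, ?_, ?_⟩
    · rw [hf', hf, ← pow_succ]
    · rw [hc', hc, ← pow_succ]
    · rw [hd', hd]
      ring

variable [TopologicalSpace Y] [CompactSpace Y] [Nonempty Y] [MeasurableSpace Y]

/-- The tensor power trick: if `max f < c`, the bound on `k`-th powers would force the masses to
grow exponentially in the degree. -/
theorem exists_le_of_limsup_log_le
    (hf : ∀ a, Continuous (f a)) (hf0 : ∀ a y, 0 ≤ f a y) (hd : ∀ a, 1 ≤ d a)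
    (hmul : ∀ a b, ∃ e, (∀ y, f e y = f a y * f b y) ∧ c e = c a * c b ∧ d e = d a + d b)
    {μ : ℕ → Measure Y}
    (hμ : limsup (fun n : ℕ => (((n : ℝ)⁻¹ : ℝ) : EReal) * ENNReal.log (μ n Set.univ)) atTop ≤ 0)
    (hint : ∀ a, ENNReal.ofReal (c a) ≤ ∫⁻ y, ENNReal.ofReal (f a y) ∂(μ (d a))) (a : ι) :
    ∃ y, c a ≤ f a y := by
  obtain ⟨y₀, -, hy₀⟩ := isCompact_univ.exists_isMaxOn Set.univ_nonempty (hf a).continuousOn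
  refine ⟨y₀, ?_⟩
  by_contra! hlt
  have hM0 := hf0 a y₀
  -- Using `M` above the maximum keeps the divisor positive even when `f` vanishes identically.
  obtain ⟨M, hM1, hM2⟩ := exists_between hlt
  have hM : 0 < M := hM0.trans_lt hM1
  have hr : 1 < c a / M := (one_lt_div hM).2 hM2
  have hda : (0 : ℝ) < d a := Nat.cast_pos.2 (hd a)
  have hδ : 0 < Real.log (c a / M) / d a := div_pos (Real.log_pos hr) hda
  have hev := eventually_lt_of_limsup_lt (hμ.trans_lt (EReal.coe_pos.2 hδ))
  obtain ⟨n₀, hn₀⟩ := eventually_atTop.1 hev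
  obtain ⟨e, hfe, hce, hde⟩ := exists_pow_of_mul hmul a n₀
  have h1 := hn₀ (d e) (by rw [hde]; nlinarith [hd a])
  have h2 : ENNReal.ofReal ((c a / M) ^ (n₀ + 1)) ≤ μ (d e) Set.univ := by
    have h3 : ∫⁻ y, ENNReal.ofReal (f e y) ∂(μ (d e)) ≤
        ENNReal.ofReal (M ^ (n₀ + 1)) * μ (d e) Set.univ := by
      rw [← lintegral_const]
      refine lintegral_mono fun y => ENNReal.ofReal_le_ofReal ?_
      rw [hfe]
      exact pow_le_pow_left₀ (hf0 a y) ((hy₀ (Set.mem_univ y)).trans hM1.le) _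
    have h4 := (hint e).trans h3
    rw [div_pow, ENNReal.ofReal_div_of_pos (by positivity), ← hce]
    exact ENNReal.div_le_of_le_mul' h4
  have h5 : (((Real.log (c a / M) / d a : ℝ)) : EReal) ≤
      (((d e : ℝ)⁻¹ : ℝ) : EReal) * ENNReal.log (μ (d e) Set.univ) := by
    have h6 := ENNReal.log_monotone h2
    rw [ENNReal.log_ofReal_of_pos (by positivity), Real.log_pow] at h6
    refine le_trans (le_of_eq ?_) (mul_le_mul_of_nonneg_left h6
      (EReal.coe_nonneg.2 (by positivity)))
    rw [← EReal.coe_mul, hde]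
    congr 1
    push_cast
    field_simp
  exact absurd h1 h5.not_gt

variable [T2Space Y] [BorelSpace Y]

theorem exists_probabilityMeasure_log_le_integral
    (hf : ∀ a, Continuous (f a)) (hf0 : ∀ a y, 0 ≤ f a y)
    (hmul : ∀ a b, ∃ e, (∀ y, f e y = f a y * f b y) ∧ c e = c a * c b ∧ d e = d a + d b)
    (hsup : ∀ a, ∃ y, c a ≤ f a y) :
    ∃ ν : Measure Y, IsProbabilityMeasure ν ∧ ∀ a, 0 < c a → ∀ k : ℕ,
      Real.log (c a) ≤ ∫ y, Real.log (max (f a y) (Real.exp (-k))) ∂ν := by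
  -- These are the continuous majorants of `(log f - log c) / N`. The exponentiated form permits
  -- zeros of `f` and contains all truncations; `N` provides closure under division by positive
  -- integers.
  let S : Set C(Y, ℝ) :=
    {g | ∃ a, 0 < c a ∧ ∃ N : ℕ, 0 < N ∧ ∀ y, f a y ≤ c a * Real.exp (N * g y)}
  have hlog : ∀ a (k : ℕ), Continuous fun y => Real.log (max (f a y) (Real.exp (-k))) :=
    fun a k => continuous_log_max_exp (hf a) k
  have hmem : ∀ a, 0 < c a → ∀ k : ℕ,
      (⟨_, hlog a k⟩ - ContinuousMap.const Y (Real.log (c a)) : C(Y, ℝ)) ∈ S := by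
    refine fun a ha k => ⟨a, ha, 1, one_pos, fun y => ?_⟩
    simp only [ContinuousMap.sub_apply, ContinuousMap.coe_mk, ContinuousMap.const_apply,
      Nat.cast_one, one_mul]
    rw [Real.exp_sub, Real.exp_log (lt_max_of_lt_right (Real.exp_pos _)), Real.exp_log ha,
      mul_div_cancel₀ _ ha.ne']
    exact le_max_left _ _
  by_cases hne : ∃ a, 0 < c a
  · obtain ⟨a₀, ha₀⟩ := hne
    suffices h : ∃ ν : Measure Y, IsProbabilityMeasure ν ∧ ∀ g ∈ S, 0 ≤ ∫ y, g y ∂ν by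
      obtain ⟨ν, hν, hint⟩ := h
      refine ⟨ν, hν, fun a ha k => ?_⟩
      have h1 := hint _ (hmem a ha k)
      simp only [ContinuousMap.sub_apply, ContinuousMap.coe_mk, ContinuousMap.const_apply] at h1
      rw [integral_sub (hlog a k).integrable_of_compactSpace (integrable_const _)] at h1
      simpa using h1
    refine exists_probabilityMeasure_integral_nonneg ⟨_, hmem a₀ ha₀ 0⟩ ?_ ?_ ?_ ?_
    · rintro g ⟨a, ha, N, hN, hg⟩ h ⟨b, hb, M, hM, hh⟩
      obtain ⟨M', rfl⟩ := Nat.exists_eq_succ_of_ne_zero hM.ne'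
      obtain ⟨N', rfl⟩ := Nat.exists_eq_succ_of_ne_zero hN.ne'
      obtain ⟨a', hfa, hca, -⟩ := exists_pow_of_mul hmul a M'
      obtain ⟨b', hfb, hcb, -⟩ := exists_pow_of_mul hmul b N'
      obtain ⟨e, hfe, hce, -⟩ := hmul a' b'
      -- Fractions are added over a common denominator: the first element is raised to the second
      -- denominator, and conversely.
      refine ⟨e, by rw [hce, hca, hcb]; positivity, (N' + 1) * (M' + 1), by positivity,
        fun y => ?_⟩
      rw [hfe, hfa, hfb, hce, hca, hcb]
      calc f a y ^ (M' + 1) * f b y ^ (N' + 1)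
          ≤ (c a * Real.exp ((N' + 1 : ℕ) * g y)) ^ (M' + 1) *
            (c b * Real.exp ((M' + 1 : ℕ) * h y)) ^ (N' + 1) := by
            have h1 := hf0 a y
            have h2 := hf0 b y
            exact mul_le_mul (pow_le_pow_left₀ h1 (hg y) _) (pow_le_pow_left₀ h2 (hh y) _)
              (by positivity) (by positivity)
        _ = _ := by
            rw [mul_pow, mul_pow, mul_mul_mul_comm, ← Real.exp_nat_mul, ← Real.exp_nat_mul,
              ← Real.exp_add, ContinuousMap.add_apply]
            congr 2
            push_cast
            ring
    · rintro g ⟨a, ha, N, hN, hg⟩ k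
      obtain ⟨a', hfa, hca, -⟩ := exists_pow_of_mul hmul a k
      refine ⟨a', by rw [hca]; positivity, N, hN, fun y => ?_⟩
      rw [hfa, hca]
      calc f a y ^ (k + 1) ≤ (c a * Real.exp (N * g y)) ^ (k + 1) :=
            pow_le_pow_left₀ (hf0 a y) (hg y) _
        _ = _ := by
            rw [mul_pow, ← Real.exp_nat_mul, ContinuousMap.smul_apply, smul_eq_mul]
            congr 2
            push_cast
            ring
    · rintro g ⟨a, ha, N, hN, hg⟩ k
      refine ⟨a, ha, N * (k + 1), by positivity, fun y => (hg y).trans_eq ?_⟩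
      rw [ContinuousMap.smul_apply, smul_eq_mul]
      congr 2
      push_cast
      field_simp
    · rintro g ⟨a, ha, N, hN, hg⟩
      obtain ⟨y, hy⟩ := hsup a
      refine ⟨y, ?_⟩
      by_contra! hneg
      have h1 : Real.exp (N * g y) < 1 := Real.exp_lt_one_iff.2
        (mul_neg_of_pos_of_neg (Nat.cast_pos.2 hN) hneg)
      have := hy.trans (hg y)
      nlinarith
  -- If no `c a` is positive, the claim is vacuous and any probability measure serves.
  · exact ⟨Measure.dirac (Classical.arbitrary Y), inferInstance,
      fun a ha => absurd ⟨a, ha⟩ hne⟩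

end MultiplicativeFamilies

/-! ### Deduction of the equivalences -/

theorem GeometricBound.arithmeticBound {Y : Type*} [TopologicalSpace Y] [CompactSpace Y]
    [MeasurableSpace Y] [BorelSpace Y] {H : Type*} [NormedAddCommGroup H] [InnerProductSpace ℂ H]
    {A : Y → H →L[ℂ] H} {C : H →L[ℂ] H}
    {X : (n : ℕ) → Set (HilbertPow H n →L[ℂ] HilbertPow H n)} {n : ℕ} {ν : Measure Y}
    [IsProbabilityMeasure ν]
    (hcont : ∀ x ∈ X n, Continuous fun y => (opTrace (opPow (A y) n * x)).re)
    (hpos : ∀ x ∈ X n, ∀ y, 0 ≤ (opTrace (opPow (A y) n * x)).re)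
    (h : GeometricBound A C X n ν) : ArithmeticBound A C X n ν :=
  fun x hx => (h x hx).trans (exp_erealIntegral_log_le (hcont x hx) (hpos x hx))

theorem mainTheorem9
    {Y : Type*} [TopologicalSpace Y] [CompactSpace Y] [T2Space Y] [Nonempty Y]
    [MeasurableSpace Y] [BorelSpace Y]
    {H : Type*} [NormedAddCommGroup H] [InnerProductSpace ℂ H] [CompleteSpace H]
    (A : Y → H →L[ℂ] H) (hA : ∀ y, (A y).IsPositive)
    (C : H →L[ℂ] H) (hC : C.IsPositive)
    (X : (n : ℕ) → Set (HilbertPow H n →L[ℂ] HilbertPow H n))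
    (hX : ∀ n, 1 ≤ n → ∀ x ∈ X n, x.IsPositive)
    (hXA : ∀ n, 1 ≤ n → ∀ x ∈ X n, ∀ y, IsTraceClass (opPow (A y) n * x))
    (hXC : ∀ n, 1 ≤ n → ∀ x ∈ X n, IsTraceClass (opPow C n * x))
    (hXmul : ∀ n m, 1 ≤ n → 1 ≤ m → ∀ x₁ ∈ X n, ∀ x₂ ∈ X m, opTensor x₁ x₂ ∈ X (n + m))
    (hXcont : ∀ n, 1 ≤ n → ∀ x ∈ X n, Continuous fun y => opTrace (opPow (A y) n * x)) :
    List.TFAE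
      [∃ ν : Measure Y, IsProbabilityMeasure ν ∧ ∀ n, 1 ≤ n → GeometricBound A C X n ν,
        ∀ n, 1 ≤ n → ∃ ν : Measure Y, IsProbabilityMeasure ν ∧ GeometricBound A C X n ν,
        ∃ μ : Measure Y, IsProbabilityMeasure μ ∧ ∀ n, 1 ≤ n → ArithmeticBound A C X n μ,
        ∃ μ : ℕ → Measure Y,
          limsup (fun n : ℕ => (((n : ℝ)⁻¹ : ℝ) : EReal) * ENNReal.log (μ n Set.univ)) atTop ≤ 0 ∧
          ∀ n, 1 ≤ n → ArithmeticBound A C X n (μ n)] ∧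
    ((∃ μ : ℕ → Measure Y,
        limsup (fun n : ℕ => (((n : ℝ)⁻¹ : ℝ) : EReal) * ENNReal.log (μ n Set.univ)) atTop ≤ 0 ∧
        ∀ n, 1 ≤ n → ArithmeticBound A C X n (μ n)) →
      ∀ n, 1 ≤ n → SupBound A C X n) := by

  have hcont : ∀ n, 1 ≤ n → ∀ x ∈ X n, Continuous fun y => (opTrace (opPow (A y) n * x)).re :=
    fun n hn x hx => Complex.continuous_re.comp (hXcont n hn x hx)
  have hpos : ∀ n, 1 ≤ n → ∀ x ∈ X n, ∀ y, 0 ≤ (opTrace (opPow (A y) n * x)).re :=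
    fun n hn x hx y => (re_opTrace_nonneg_and_im_eq_zero (hA y) (hX n hn x hx) (hXA n hn x hx y)).1
  let ι := {p : Σ n, (HilbertPow H n →L[ℂ] HilbertPow H n) // 1 ≤ p.1 ∧ p.2 ∈ X p.1}
  let f : ι → Y → ℝ := fun p y => (opTrace (opPow (A y) p.1.1 * p.1.2)).re
  let c : ι → ℝ := fun p => (opTrace (opPow C p.1.1 * p.1.2)).re
  let d : ι → ℕ := fun p => p.1.1
  have hf : ∀ p, Continuous (f p) := fun p => hcont _ p.2.1 _ p.2.2
  have hf0 : ∀ p y, 0 ≤ f p y := fun p => hpos _ p.2.1 _ p.2.2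
  have hd : ∀ p, 1 ≤ d p := fun p => p.2.1
  have hmul : ∀ p q, ∃ e, (∀ y, f e y = f p y * f q y) ∧ c e = c p * c q ∧ d e = d p + d q := by
    rintro ⟨⟨n, x₁⟩, hn, hx₁⟩ ⟨⟨m, x₂⟩, hm, hx₂⟩
    have hnm : 1 ≤ n + m := le_add_right hn
    have hx := hXmul n m hn hm x₁ hx₁ x₂ hx₂
    refine ⟨⟨⟨n + m, opTensor x₁ x₂⟩, hnm, hx⟩, fun y => ?_, ?_, rfl⟩
    · exact re_opTrace_opTensor (hA y) (hX n hn x₁ hx₁) (hXA n hn x₁ hx₁ y) (hXA m hm x₂ hx₂ y)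
        (hXA _ hnm _ hx y)
    · exact re_opTrace_opTensor hC (hX n hn x₁ hx₁) (hXC n hn x₁ hx₁) (hXC m hm x₂ hx₂)
        (hXC _ hnm _ hx)
  have hsup : ∀ μ : ℕ → Measure Y,
      limsup (fun n : ℕ => (((n : ℝ)⁻¹ : ℝ) : EReal) * ENNReal.log (μ n Set.univ)) atTop ≤ 0 →
      (∀ n, 1 ≤ n → ArithmeticBound A C X n (μ n)) → ∀ p, ∃ y, c p ≤ f p y :=
    fun μ hμ hb p => exists_le_of_limsup_log_le hf hf0 hd hmul hμ
      (fun q => hb _ q.2.1 _ q.2.2) p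
  have hone : ∀ μ : ℕ → Measure Y, (∀ n, 1 ≤ n → IsProbabilityMeasure (μ n)) →
      limsup (fun n : ℕ => (((n : ℝ)⁻¹ : ℝ) : EReal) * ENNReal.log (μ n Set.univ)) atTop ≤ 0 := by
    intro μ hμ
    refine le_of_eq (Tendsto.limsup_eq (tendsto_const_nhds.congr' ?_))
    -- The measure at index `0` is unconstrained, but does not affect the limit superior.
    filter_upwards [eventually_ge_atTop 1] with n hn
    have := hμ n hn
    rw [measure_univ, ENNReal.log_one, mul_zero]
  refine ⟨?_, ?_⟩
  · tfae_have 1 → 2 := fun ⟨ν, hν, h⟩ n hn => ⟨ν, hν, h n hn⟩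
    tfae_have 1 → 3 := fun ⟨ν, hν, h⟩ =>
      ⟨ν, hν, fun n hn => (h n hn).arithmeticBound (hcont n hn) (hpos n hn)⟩
    tfae_have 2 → 4 := by
      intro h
      choose! ν hν hb using h
      refine ⟨ν, hone ν hν, fun n hn => ?_⟩
      have := hν n hn
      exact (hb n hn).arithmeticBound (hcont n hn) (hpos n hn)
    tfae_have 3 → 4 := fun ⟨μ, hμ, h⟩ => ⟨fun _ => μ, hone _ fun _ _ => hμ, h⟩
    tfae_have 4 → 1 := by
      rintro ⟨μ, hμ, hb⟩
      obtain ⟨ν, hν, hlog⟩ :=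
        exists_probabilityMeasure_log_le_integral hf hf0 hmul (hsup μ hμ hb)
      refine ⟨ν, hν, fun n hn x hx => ?_⟩
      let p : ι := ⟨⟨n, x⟩, hn, hx⟩
      change ENNReal.ofReal (c p) ≤ EReal.exp (erealIntegral ν fun y =>
        ENNReal.log (ENNReal.ofReal (f p y)))
      -- When the left-hand trace vanishes, the bound is trivial and no logarithm of it is needed.
      rcases le_or_gt (c p) 0 with hc | hc
      · rw [ENNReal.ofReal_of_nonpos hc]
        exact zero_le
      · have h1 := EReal.exp_monotone (le_erealIntegral_log (hf p) (hf0 p) (hlog p hc))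
        rwa [EReal.exp_coe, Real.exp_log hc] at h1
    tfae_finish
  · rintro ⟨μ, hμ, hb⟩ n hn x hx
    obtain ⟨y, hy⟩ := hsup μ hμ hb ⟨⟨n, x⟩, hn, hx⟩
    exact le_iSup_of_le y (ENNReal.ofReal_le_ofReal hy)
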